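/- **Setting.** Let $0<A_1<A_2$ and let $u_0\in C^2(\mathbb R)$ be real valued with $u_0(x)\to A_1$ as $x\to-\infty$, $u_0(x)\to A_2$ as $x\to+\infty$, and such that $m_0:=u_0-u_0''$ satisfies $m_0>0$, $m_0-A_1\in L^1(-\infty,0)$ and $m_0-A_2\in L^1(0,\infty)$. For $j=1,2$ put $$\dot\Sigma_j=\{\lambda\in\mathbb R:|\lambda|>1/A_j\},\qquad \dot\Sigma_0=\{\lambda\in\mathbb R: 1/A_2<|\lambda|<1/A_1\},\qquad \dot\Gamma_2=(-1/A_2,1/A_2),$$ and let $l_j(\lambda)=\sqrt{\lambda^2-A_j^{-2}}$ be the branch with cut $[-1/A_j,1/A_j]$ and $l_j(\lambda)\sim\lambda$ at infinity; on the cut $l_j$ denotes below the boundary value $l_j(\lambda_+)$ from the upper half-plane. **Reflection coefficient.** Let $$U=\frac12\begin{pmatrix}-1&\lambda m_0(x)\\-\lambda m_0(x)&1\end{pmatrix},\qquad H_j=\sqrt{\tfrac12}\,\sqrt{\tfrac1{\mathrm i A_jl_j}-1}\begin{pmatrix}\frac{\lambda A_j}{1-\mathrm i A_jl_j}&-1\\-1&\frac{\lambda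 A_j}{1-\mathrm iA_jl_j}\end{pmatrix}$$ (second root with cut $[0,\infty)$ and $\sqrt{-1}=\mathrm i$) and $f_j(x)=\mathrm iA_jl_j(\lambda)\big(\frac1{2A_j}\int_{(-1)^j\infty}^x(m_0-A_j)\,d\xi+\frac x2\big)$. For $\lambda\in\dot\Sigma_1\cup\dot\Sigma_0$ let $\Psi_1^{(1)},\Psi_2^{(1)},\Psi_2^{(2)}$ be the $\mathbb C^2$-valued solutions of $\psi_x=U\psi$ with $$e^{f_1}H_1\Psi_1^{(1)}\to\binom10\ (x\to-\infty),\qquad e^{f_2}H_2\Psi_2^{(1)}\to\binom10,\quad e^{-f_2}H_2\Psi_2^{(2)}\to\binom01\ (x\to+\infty),$$ write $\Psi_1^{(1)}=c_{11}\Psi_2^{(1)}+c_{21}\Psi_2^{(2)}$, and let $r(\lambda)=c_{21}(\lambda)/c_{11}(\lambda)$. **Jump matrix.** For $y\in\mathbb R$ and $t>0$ let $\hat f_2(\lambda)=\frac{\mathrm iA_2l_2(\lambda)}2\big(y-\frac{2t}{\lambda^2}\big)$. Let $\hat G(\lambda)=\begin{pmatrix}0&-\mathrm i\\-\mathrm i&0\end{pmatrix}$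 on $\dot\Gamma_2$, and on $\dot\Sigma_1\cup\dot\Sigma_0$ let $$\hat G(\lambda)=\begin{pmatrix}e^{-\hat f_2}&0\\0&e^{\hat f_2}\end{pmatrix}G_0(\lambda)\begin{pmatrix}e^{\hat f_2}&0\\0&e^{-\hat f_2}\end{pmatrix},$$ where $$G_0=\begin{pmatrix}1-|r|^2&-\bar r\\r&1\end{pmatrix}\text{ on }\dot\Sigma_1,\qquad G_0=\begin{pmatrix}0&-1/r\\r&1\end{pmatrix}\text{ on }\dot\Sigma_0.$$ **Proposition (vanishing lemma).** Let $y\in\mathbb R$, $t>0$, and let $m:\mathbb C\setminus\mathbb R\to\mathbb C^{2\times2}$ be analytic and such that * at every $\lambda\in\mathbb R\setminus\{\pm1/A_1,\pm1/A_2\}$ the limits $m_\pm(\lambda)$ of $m$ from the open upper and lower half-planes exist, and $m_+(\lambda)=m_-(\lambda)\hat G(\lambda)$; * $m(\lambda)=O(1/\lambda)$ as $\lambda\to\infty$ in $\mathbb C\setminus\mathbb R$; * $m(\lambda)=O(|\lambda-s|^{-1/4})$ as $\lambda\to s$ in $\mathbb C\setminus\mathbb R$, for each $s\in\{\pm1/A_1,\pm1/A_2\}$.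 Then $m\equiv0$. -/

import Mathlib

/-! Step-like modified Camassa-Holm problem: the reflection coefficient of the initial profile,
the jump matrix of the right Riemann-Hilbert problem, and its homogeneous version. -/

namespace StepMCH

open Filter Topology MeasureTheory Asymptotics

noncomputable section

/-- The open half-lines `(-∞, -1/A) ∪ (1/A, ∞)`. -/
def sigmaDot (A : ℝ) : Set ℝ := {lam | 1 / A < |lam|}

/-- The open intervals `(-1/A₁, -1/A₂) ∪ (1/A₂, 1/A₁)`. -/
def sigmaZeroDot (A₁ A₂ : ℝ) : Set ℝ := {lam | 1 / A₂ < |lam| ∧ |lam| < 1 / A₁}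

/-- The open segment `(-1/A, 1/A)`. -/
def gammaDot (A : ℝ) : Set ℝ := {lam | |lam| < 1 / A}

/-- The root `l(z) = √(z² - 1/A²)` with branch cut `[-1/A, 1/A]` and `l(z) ~ z` at infinity.
It is written as a product of two principal roots (argument in `(-π, π]`); the two cuts cancel on
`(-∞, -1/A)`.  At a real point `z` of the cut the formula gives the boundary value `l(z₊)` from the
upper half plane. -/
def rootL (A : ℝ) (z : ℂ) : ℂ :=
  (z - ((1 / A : ℝ) : ℂ)) ^ (1 / 2 : ℂ) * (z + ((1 / A : ℝ) : ℂ)) ^ (1 / 2 : ℂ)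

/-- The square root with branch cut `[0, ∞)` and `√(-1) = i`. -/
def sqrtCut (z : ℂ) : ℂ := Complex.I * (-z) ^ (1 / 2 : ℂ)

/-- The momentum `u₀ - u₀''`. -/
def momentum (u₀ : ℝ → ℝ) (x : ℝ) : ℝ := u₀ x - deriv (deriv u₀) x

/-- The coefficient matrix of the `x`-equation of the Lax pair, for momentum value `μ`. -/
def laxU (μ : ℝ) (z : ℂ) : Matrix (Fin 2) (Fin 2) ℂ :=
  (1 / 2 : ℂ) • !![-1, z * μ; -(z * μ), 1]

/-- `ψ` is a (column) solution of the `x`-equation `ψ' = U ψ` of the Lax pair. -/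
def IsLaxSolution (m₀ : ℝ → ℝ) (z : ℂ) (ψ : ℝ → Fin 2 → ℂ) : Prop :=
  ∀ x : ℝ, HasDerivAt ψ ((laxU (m₀ x) z).mulVec (ψ x)) x

/-- The gauge matrix `H` attached to the background `A`. -/
def gaugeH (A : ℝ) (z : ℂ) : Matrix (Fin 2) (Fin 2) ℂ :=
  (((Real.sqrt (1 / 2) : ℝ) : ℂ) * sqrtCut (1 / (Complex.I * A * rootL A z) - 1)) •
    !![z * A / (1 - Complex.I * A * rootL A z), -1;
       -1, z * A / (1 - Complex.I * A * rootL A z)]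

/-- The phase at time `0` normalized at `-∞`:
`i A l(z) ((1/(2A)) ∫_{-∞}^x (m₀ - A) + x/2)`. -/
def phaseLeft (A : ℝ) (m₀ : ℝ → ℝ) (x : ℝ) (z : ℂ) : ℂ :=
  Complex.I * A * rootL A z *
    ((1 / (2 * A) * (∫ ξ in Set.Iic x, (m₀ ξ - A)) + x / 2 : ℝ) : ℂ)

/-- The phase at time `0` normalized at `+∞`:
`i A l(z) ((1/(2A)) ∫_{+∞}^x (m₀ - A) + x/2)`. -/
def phaseRight (A : ℝ) (m₀ : ℝ → ℝ) (x : ℝ) (z : ℂ) : ℂ :=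
  Complex.I * A * rootL A z *
    ((1 / (2 * A) * (-∫ ξ in Set.Ioi x, (m₀ ξ - A)) + x / 2 : ℝ) : ℂ)

/-- First column of the left Jost solution: `e^{f₁} H₁ ψ → (1, 0)ᵀ` as `x → -∞`. -/
def IsJostLeftFst (A : ℝ) (m₀ : ℝ → ℝ) (z : ℂ) (ψ : ℝ → Fin 2 → ℂ) : Prop :=
  IsLaxSolution m₀ z ψ ∧
    Tendsto (fun x => Complex.exp (phaseLeft A m₀ x z) • (gaugeH A z).mulVec (ψ x))
      atBot (𝓝 ![1, 0])

/-- First column of the right Jost solution: `e^{f₂} H₂ ψ → (1, 0)ᵀ` as `x → +∞`. -/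
def IsJostRightFst (A : ℝ) (m₀ : ℝ → ℝ) (z : ℂ) (ψ : ℝ → Fin 2 → ℂ) : Prop :=
  IsLaxSolution m₀ z ψ ∧
    Tendsto (fun x => Complex.exp (phaseRight A m₀ x z) • (gaugeH A z).mulVec (ψ x))
      atTop (𝓝 ![1, 0])

/-- Second column of the right Jost solution: `e^{-f₂} H₂ ψ → (0, 1)ᵀ` as `x → +∞`. -/
def IsJostRightSnd (A : ℝ) (m₀ : ℝ → ℝ) (z : ℂ) (ψ : ℝ → Fin 2 → ℂ) : Prop :=
  IsLaxSolution m₀ z ψ ∧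
    Tendsto (fun x => Complex.exp (-phaseRight A m₀ x z) • (gaugeH A z).mulVec (ψ x))
      atTop (𝓝 ![0, 1])

/-- Step-like initial profile with the two backgrounds `A₁` (at `-∞`) and `A₂` (at `+∞`) and
positive momentum. -/
structure IsStepLike (A₁ A₂ : ℝ) (u₀ : ℝ → ℝ) : Prop where
  smooth : ContDiff ℝ 2 u₀
  momentum_pos : ∀ x, 0 < momentum u₀ x
  tendsto_left : Tendsto u₀ atBot (𝓝 A₁)
  tendsto_right : Tendsto u₀ atTop (𝓝 A₂)
  integrable_left : IntegrableOn (fun x => momentum u₀ x - A₁) (Set.Iic 0)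
  integrable_right : IntegrableOn (fun x => momentum u₀ x - A₂) (Set.Ici 0)

/-- `r` is the (right) reflection coefficient of `u₀`: on `Σ̇₁ ∪ Σ̇₀`, `r = c₂₁ / c₁₁`, where
`Ψ₁⁽¹⁾ = c₁₁ Ψ₂⁽¹⁾ + c₂₁ Ψ₂⁽²⁾`; on `Σ̇₀` the left Jost solution is taken on the upper side. -/
def IsReflectionCoefficient (A₁ A₂ : ℝ) (u₀ : ℝ → ℝ) (r : ℝ → ℂ) : Prop :=
  ∀ lam ∈ sigmaDot A₁ ∪ sigmaZeroDot A₁ A₂,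
    ∃ (ψ φ₁ φ₂ : ℝ → Fin 2 → ℂ) (c₁₁ c₂₁ : ℂ),
      IsJostLeftFst A₁ (momentum u₀) lam ψ ∧
      IsJostRightFst A₂ (momentum u₀) lam φ₁ ∧
      IsJostRightSnd A₂ (momentum u₀) lam φ₂ ∧
      (∀ x, ψ x = c₁₁ • φ₁ x + c₂₁ • φ₂ x) ∧
      r lam = c₂₁ / c₁₁

/-- The phase `f̂₂(y,t,z) = (i A₂ l₂(z) / 2) (y - 2t/z²)`. -/
def phaseHat (A₂ y t : ℝ) (z : ℂ) : ℂ :=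
  Complex.I * A₂ * rootL A₂ z / 2 * (y - 2 * t / z ^ 2)

open Classical in
/-- The matrix `G₀` on `Σ̇₁` and on `Σ̇₀`. -/
def jumpCore (A₁ : ℝ) (r : ℝ → ℂ) (lam : ℝ) : Matrix (Fin 2) (Fin 2) ℂ :=
  if lam ∈ sigmaDot A₁ then
    !![1 - ((‖r lam‖ ^ 2 : ℝ) : ℂ), -(starRingEnd ℂ) (r lam); r lam, 1]
  else
    !![0, -(1 / r lam); r lam, 1]

open Classical in
/-- The jump matrix `Ĝ(y,t,λ)`, `λ ∈ ℝ ∖ {±1/A₁, ±1/A₂}`: `-i σ₁` on `Γ̇₂` and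
`diag(e^{-f̂₂}, e^{f̂₂}) G₀ diag(e^{f̂₂}, e^{-f̂₂})` on `Σ̇₁ ∪ Σ̇₀`. -/
def jumpMatrix (A₁ A₂ : ℝ) (r : ℝ → ℂ) (y t lam : ℝ) : Matrix (Fin 2) (Fin 2) ℂ :=
  if lam ∈ gammaDot A₂ then
    !![0, -Complex.I; -Complex.I, 0]
  else
    !![Complex.exp (-phaseHat A₂ y t lam), 0; 0, Complex.exp (phaseHat A₂ y t lam)] *
      jumpCore A₁ r lam *
      !![Complex.exp (phaseHat A₂ y t lam), 0; 0, Complex.exp (-phaseHat A₂ y t lam)]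

/-- The complement of the real line. -/
def offReal : Set ℂ := {z | z.im ≠ 0}

/-- The exceptional points `±1/A₁, ±1/A₂` of the contour. -/
def branchPoints (A₁ A₂ : ℝ) : Set ℝ := {1 / A₁, -(1 / A₁), 1 / A₂, -(1 / A₂)}

/-- `m` solves the homogeneous right Riemann-Hilbert problem (no poles) with parameters `y, t`.
Only the values of `m` off the real line matter; the boundary values in `jump` are the limits
from the open upper and lower half planes. -/
structure IsHomogeneousSolution (A₁ A₂ : ℝ) (r : ℝ → ℂ) (y t : ℝ)
    (m : ℂ → Matrix (Fin 2) (Fin 2) ℂ) : Prop where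
  analytic : ∀ i j, DifferentiableOn ℂ (fun z => m z i j) offReal
  jump : ∀ lam : ℝ, lam ∉ branchPoints A₁ A₂ →
    ∃ mPlus mMinus : Matrix (Fin 2) (Fin 2) ℂ,
      Tendsto m (𝓝[{z : ℂ | 0 < z.im}] (lam : ℂ)) (𝓝 mPlus) ∧
      Tendsto m (𝓝[{z : ℂ | z.im < 0}] (lam : ℂ)) (𝓝 mMinus) ∧
      mPlus = mMinus * jumpMatrix A₁ A₂ r y t lam
  decay : ∀ i j, (fun z => m z i j) =O[Bornology.cobounded ℂ ⊓ 𝓟 offReal] (fun z : ℂ => z⁻¹)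
  singularity : ∀ s ∈ branchPoints A₁ A₂, ∀ i j,
    (fun z => m z i j) =O[𝓝[offReal] (s : ℂ)] (fun z : ℂ => ‖z - (s : ℂ)‖ ^ (-(1 / 4) : ℝ))

end

end StepMCH

namespace StepMCH

open Filter Topology MeasureTheory Asymptotics

/-! For each row of `m`, the function `hermRow m i`, a diagonal entry of m(z) m(z̄)*, is analytic in
the upper half-plane, is O(1/z²) at infinity, and has singularities of order at most -1/2 at the
branch points. By Cauchy's theorem its boundary values therefore integrate to zero over the real
line. The jump relation turns these boundary values into v G v*, where v is the row of the lower
boundary value and G the jump matrix.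

The real part of v G v* is never negative: it is (1-|r|²)|v₀|²+|v₁|² on Σ̇₁, |v₁|² on Σ̇₀, and 0 on
Γ̇₂. So it vanishes identically (`boundary_re_eq_zero`). On Σ̇₁ both weights are positive, which
forces both boundary values of `m` to be zero there. Boundary uniqueness
(`eq_zero_of_boundary_eq_zero`) then kills `m` in each half-plane.

The bounds |r|<1 on Σ̇₁ and |r|=1 on Σ̇₀ come from the conserved form Im(ψ₀ψ̄₁) of the Lax equation.
At +∞ twice this form equals |c₁₁|²-|c₂₁|²; at -∞ it equals 1 if the left Jost solution oscillates
and 0 if it decays. -/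

/-! ### Integrals of boundary values along the real line -/

/-- The open upper half plane, as a set of complex numbers. -/
abbrev upperSet : Set ℂ := {z : ℂ | 0 < z.im}

theorem ofReal_mem_closure_upperSet (x : ℝ) : (x : ℂ) ∈ closure upperSet := by
  have h : closure upperSet = {z : ℂ | 0 ≤ z.im} := Complex.closure_setOfPred_lt_im 0
  rw [h]; simp

theorem intervalIntegrable_abs_sub_rpow {r : ℝ} (hr : -1 < r) (s a b : ℝ) :
    IntervalIntegrable (fun x => |x - s| ^ r) volume a b := by
  have h0 : ∀ c : ℝ, IntervalIntegrable (fun x : ℝ => |x| ^ r) volume 0 c := fun c =>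
    intervalIntegrable_of_even (f := fun x : ℝ => |x| ^ r) (fun x => by simp)
      (fun c hc => (intervalIntegral.intervalIntegrable_rpow' (a := 0) (b := c) hr).congr
        (fun x hx => by
          rw [Set.uIoc_of_le hc.le] at hx
          simp [abs_of_pos hx.1])) enorm_ne_top enorm_ne_top
  simpa using ((h0 (a - s)).symm.trans (h0 (b - s))).comp_sub_right s

/-- The weight `1 + ∑ ‖z - s‖ ^ (-1/2)` controlling inverse square root singularities. -/
noncomputable def singWeight (S : Finset ℝ) (z : ℂ) : ℝ :=
  1 + ∑ s ∈ S, ‖z - (s : ℂ)‖ ^ (-(1 / 2) : ℝ)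

theorem one_le_singWeight (S : Finset ℝ) (z : ℂ) : 1 ≤ singWeight S z := by
  have : 0 ≤ ∑ s ∈ S, ‖z - (s : ℂ)‖ ^ (-(1 / 2) : ℝ) :=
    Finset.sum_nonneg fun s _ => Real.rpow_nonneg (norm_nonneg _) _
  unfold singWeight; linarith

theorem rpow_le_singWeight {S : Finset ℝ} {s : ℝ} (hs : s ∈ S) (z : ℂ) :
    ‖z - (s : ℂ)‖ ^ (-(1 / 2) : ℝ) ≤ singWeight S z := by
  have := Finset.single_le_sum (f := fun s : ℝ => ‖z - (s : ℂ)‖ ^ (-(1 / 2) : ℝ))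
    (fun s _ => Real.rpow_nonneg (norm_nonneg _) _) hs
  unfold singWeight; linarith

theorem intervalIntegrable_singWeight (S : Finset ℝ) (a b : ℝ) :
    IntervalIntegrable (fun x : ℝ => singWeight S x) volume a b := by
  unfold singWeight
  refine intervalIntegrable_const.add ?_
  have := IntervalIntegrable.sum (μ := volume) (a := a) (b := b) S
    (f := fun s x => |x - s| ^ (-(1 / 2) : ℝ))
    (fun s _ => intervalIntegrable_abs_sub_rpow (by norm_num) s a b)
  refine this.congr fun x _ => ?_
  simp only [Finset.sum_apply]
  refine Finset.sum_congr rfl fun s _ => ?_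
  rw [← Complex.ofReal_sub, Complex.norm_real, Real.norm_eq_abs]

/-- Moving vertically off the axis only increases the distance to each real point, so one weight on
the axis dominates all shifted lines. At a point of `S` this fails, because `0 ^ (-1/2)` is `0`. -/
theorem singWeight_add_mul_I_le {S : Finset ℝ} {x : ℝ} (hx : x ∉ S) (ε : ℝ) :
    singWeight S (x + ε * Complex.I) ≤ singWeight S x := by
  unfold singWeight
  refine add_le_add le_rfl (Finset.sum_le_sum fun s hs => ?_)
  have hne : x ≠ s := fun h => hx (h ▸ hs)
  have hpos : 0 < ‖(x : ℂ) - s‖ := norm_pos_iff.2 (by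
    rw [← Complex.ofReal_sub]; exact_mod_cast sub_ne_zero.2 hne)
  refine Real.rpow_le_rpow_of_nonpos (z := -(1 / 2)) hpos ?_ (by norm_num)
  have h := Complex.abs_re_le_norm ((x : ℂ) + ε * Complex.I - s)
  rw [← Complex.ofReal_sub, Complex.norm_real, Real.norm_eq_abs]
  simpa using h

/-- The bound is local: continuity gives it at interior points, the limit at regular boundary
points, the growth condition at points of `S`. Compactness makes it uniform. -/
theorem exists_norm_le_singWeight {F : ℂ → ℂ} {S : Finset ℝ} (hc : ContinuousOn F upperSet)
    (hlim : ∀ x : ℝ, x ∉ S → ∃ y, Tendsto F (𝓝[upperSet] x) (𝓝 y))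
    (hsing : ∀ s ∈ S, ∃ C, ∀ᶠ z in 𝓝[upperSet] (s : ℂ),
      ‖F z‖ ≤ C * ‖z - (s : ℂ)‖ ^ (-(1 / 2) : ℝ))
    {K : Set ℂ} (hK : IsCompact K) (hK0 : K ⊆ {z | 0 ≤ z.im}) :
    ∃ C, 0 ≤ C ∧ ∀ z ∈ K, 0 < z.im → ‖F z‖ ≤ C * singWeight S z := by
  refine hK.induction_on (p := fun K => ∃ C, 0 ≤ C ∧ ∀ z ∈ K, 0 < z.im → ‖F z‖ ≤ C * singWeight S z)
    ⟨0, le_rfl, by simp⟩ (fun s t hst ⟨C, h0, h⟩ => ⟨C, h0, fun z hz => h z (hst hz)⟩) ?_ ?_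
  · rintro s t ⟨C, h0, h⟩ ⟨D, h0', h'⟩
    refine ⟨max C D, le_max_of_le_left h0, fun z hz hi => ?_⟩
    have hW := zero_le_one.trans (one_le_singWeight S z)
    rcases hz with hz | hz
    · exact (h z hz hi).trans (by gcongr; exact le_max_left _ _)
    · exact (h' z hz hi).trans (by gcongr; exact le_max_right _ _)
  · intro z hz
    suffices H : ∃ C, 0 ≤ C ∧ ∀ᶠ w in 𝓝[upperSet] z, ‖F w‖ ≤ C * singWeight S w by
      obtain ⟨C, h0, h⟩ := H
      exact ⟨_, mem_nhdsWithin_of_mem_nhds (eventually_nhdsWithin_iff.1 h), C, h0,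
        fun w hw hi => hw hi⟩
    have of_lim : ∀ y, Tendsto F (𝓝[upperSet] z) (𝓝 y) →
        ∃ C, 0 ≤ C ∧ ∀ᶠ w in 𝓝[upperSet] z, ‖F w‖ ≤ C * singWeight S w := fun y hy => by
      refine ⟨‖y‖ + 1, by positivity, ?_⟩
      filter_upwards [hy.norm.eventually (gt_mem_nhds (lt_add_one ‖y‖))] with w hw
      exact hw.le.trans (le_mul_of_one_le_right (by positivity) (one_le_singWeight S w))
    have hz0 : 0 ≤ z.im := hK0 hz
    rcases hz0.eq_or_lt with h | h
    · obtain ⟨x, rfl⟩ : ∃ x : ℝ, (x : ℂ) = z := ⟨z.re, Complex.ext (by simp) (by simp [h])⟩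
      by_cases hx : x ∈ S
      · obtain ⟨C, hC⟩ := hsing x hx
        refine ⟨|C|, abs_nonneg _, ?_⟩
        filter_upwards [hC] with w hw
        refine hw.trans ?_
        have := Real.rpow_nonneg (norm_nonneg (w - (x : ℂ))) (-(1 / 2) : ℝ)
        gcongr
        · exact le_abs_self C
        · exact rpow_le_singWeight hx w
      · obtain ⟨y, hy⟩ := hlim x hx
        exact of_lim y hy
    · exact of_lim _ (hc z h)

/-- Cauchy's theorem on the rectangle of height `R` standing on the segment. The other three sides
have total length `4R` and stay at distance at least `R` from the origin, where `F` is at most `C /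
R ^ 2`. -/
theorem norm_integral_horizontal_le {F : ℂ → ℂ} (hF : DifferentiableOn ℂ F upperSet)
    {C R₀ : ℝ} (hdecay : ∀ z : ℂ, 0 < z.im → R₀ ≤ ‖z‖ → ‖F z‖ ≤ C / ‖z‖ ^ 2)
    (hC : 0 ≤ C) {R ε : ℝ} (hR : 0 < R) (hR₀ : R₀ ≤ R) (hε : 0 < ε) :
    ‖∫ x in -R..R, F (x + ε * Complex.I)‖ ≤ 4 * C / R := by
  have key := Complex.integral_boundary_rect_eq_zero_of_differentiableOn F
    (-R + ε * Complex.I) (R + (R + ε : ℝ) * Complex.I) (hF.mono (by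
      intro z hz
      have h2 : z.im ∈ Set.uIcc _ _ := hz.2
      have e1 : ((-R : ℂ) + ε * Complex.I).im = ε := by simp
      have e2 : ((R : ℂ) + (R + ε : ℝ) * Complex.I).im = R + ε := by simp
      rw [e1, e2, Set.uIcc_of_le (by linarith)] at h2
      exact hε.trans_le h2.1))
  have hbd : ∀ z : ℂ, 0 < z.im → R ≤ ‖z‖ → ‖F z‖ ≤ C / R ^ 2 := fun z hz hz' =>
    (hdecay z hz (hR₀.trans hz')).trans (by gcongr)
  have hb1 : ‖∫ x in -R..R, F (x + (R + ε : ℝ) * Complex.I)‖ ≤ C / R ^ 2 * |R - -R| := by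
    refine intervalIntegral.norm_integral_le_of_norm_le_const fun x _ => hbd _ ?_ ?_
    · simp; linarith
    · have := Complex.abs_im_le_norm ((x : ℂ) + (R + ε : ℝ) * Complex.I)
      have e : ((x : ℂ) + (R + ε : ℝ) * Complex.I).im = R + ε := by simp
      rw [e, abs_of_pos (by linarith)] at this
      linarith
  have hb2 : ∀ a : ℝ, |a| = R →
      ‖∫ y in ε..(R + ε), F (a + y * Complex.I)‖ ≤ C / R ^ 2 * |R + ε - ε| := by
    intro a ha
    refine intervalIntegral.norm_integral_le_of_norm_le_const fun y hy => hbd _ ?_ ?_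
    · rw [Set.uIoc_of_le (by linarith)] at hy
      simpa using hε.trans hy.1
    · have := Complex.abs_re_le_norm ((a : ℂ) + y * Complex.I)
      simpa [ha] using this
  have hr := hb2 R (abs_of_pos hR)
  have hl := hb2 (-R) (by rw [abs_neg, abs_of_pos hR])
  simp only [Complex.add_re, Complex.neg_re, Complex.ofReal_re, Complex.mul_re, Complex.I_re,
    mul_zero, Complex.ofReal_im, Complex.I_im, mul_one, sub_self, add_zero, Complex.add_im,
    Complex.neg_im, neg_zero, Complex.mul_im, zero_add, smul_eq_mul] at key
  have e : ∫ x in -R..R, F (x + ε * Complex.I) =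
      (∫ x in -R..R, F (x + (R + ε : ℝ) * Complex.I))
      - Complex.I * (∫ y in ε..(R + ε), F (R + y * Complex.I))
      + Complex.I * (∫ y in ε..(R + ε), F ((-R : ℝ) + y * Complex.I)) := by
    linear_combination key
  rw [e]
  refine (norm_add_le _ _).trans ((add_le_add (norm_sub_le _ _) le_rfl).trans ?_)
  rw [norm_mul, norm_mul, Complex.norm_I, one_mul, one_mul]
  have e3 : |R - -R| = 2 * R := by rw [abs_of_pos (by linarith)]; ring
  have e4 : |R + ε - ε| = R := by rw [add_sub_cancel_right, abs_of_pos hR]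
  rw [e3] at hb1
  rw [e4] at hr hl
  have e5 : 4 * C / R = C / R ^ 2 * (2 * R) + C / R ^ 2 * R + C / R ^ 2 * R := by
    field_simp; ring
  linarith

theorem tendsto_add_mul_I_nhdsWithin (x : ℝ) :
    Tendsto (fun ε : ℝ => (x : ℂ) + ε * Complex.I) (𝓝[>] 0) (𝓝[upperSet] x) := by
  refine tendsto_nhdsWithin_iff.2 ⟨?_, ?_⟩
  · have : Tendsto (fun ε : ℝ => (x : ℂ) + ε * Complex.I) (𝓝 0) (𝓝 (x + (0 : ℝ) * Complex.I)) :=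
      Continuous.tendsto (by fun_prop) 0
    simpa using this.mono_left nhdsWithin_le_nhds
  · filter_upwards [self_mem_nhdsWithin] with ε hε
    simpa using hε

/-- The bound on horizontal segments does not depend on their height, so it survives the limit by
dominated convergence with a multiple of `singWeight` as majorant. -/
theorem boundary_integral_bound {F : ℂ → ℂ} {G : ℝ → ℂ} {S : Finset ℝ}
    (hF : DifferentiableOn ℂ F upperSet)
    {C R₀ : ℝ} (hdecay : ∀ z : ℂ, 0 < z.im → R₀ ≤ ‖z‖ → ‖F z‖ ≤ C / ‖z‖ ^ 2) (hC : 0 ≤ C)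
    (hlim : ∀ x : ℝ, x ∉ S → Tendsto F (𝓝[upperSet] x) (𝓝 (G x)))
    (hsing : ∀ s ∈ S, ∃ C, ∀ᶠ z in 𝓝[upperSet] (s : ℂ),
      ‖F z‖ ≤ C * ‖z - (s : ℂ)‖ ^ (-(1 / 2) : ℝ))
    {R : ℝ} (hR : 0 < R) (hR₀ : R₀ ≤ R) :
    IntervalIntegrable G volume (-R) R ∧ ‖∫ x in -R..R, G x‖ ≤ 4 * C / R := by
  have hS : ∀ᵐ x : ℝ, x ∉ S := by
    have := (S.finite_toSet.measure_zero volume)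
    exact (measure_eq_zero_iff_ae_notMem.1 this)
  obtain ⟨D, hD0, hD⟩ := exists_norm_le_singWeight (S := S) hF.continuousOn
    (fun x hx => ⟨_, hlim x hx⟩) hsing
    (K := Set.Icc (-R) R ×ℂ Set.Icc 0 1) (isCompact_Icc.reProdIm isCompact_Icc)
    (fun z hz => hz.2.1)
  have hcont : ∀ ε : ℝ, 0 < ε → Continuous (fun x : ℝ => F (x + ε * Complex.I)) := fun ε hε =>
    hF.continuousOn.comp_continuous (by fun_prop) (fun x => by simpa using hε)
  have hIoo : ∀ᶠ ε : ℝ in 𝓝[>] 0, ε ∈ Set.Ioo (0 : ℝ) 1 := Ioo_mem_nhdsGT one_pos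
  have hbound : ∀ ε ∈ Set.Ioo (0 : ℝ) 1, ∀ x ∈ Set.uIoc (-R) R, x ∉ S →
      ‖F (x + ε * Complex.I)‖ ≤ D * singWeight S x := fun ε hε x hx hxS => by
    rw [Set.uIoc_of_le (by linarith)] at hx
    refine (hD _ ⟨by simpa using ⟨hx.1.le, hx.2⟩, by simpa using ⟨hε.1.le, hε.2.le⟩⟩
      (by simpa using hε.1)).trans ?_
    exact mul_le_mul_of_nonneg_left (singWeight_add_mul_I_le hxS ε) hD0
  have hlim' : ∀ x, x ∉ S →
      Tendsto (fun ε : ℝ => F (x + ε * Complex.I)) (𝓝[>] 0) (𝓝 (G x)) :=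
    fun x hx => (hlim x hx).comp (tendsto_add_mul_I_nhdsWithin x)
  have hW : IntervalIntegrable (fun x : ℝ => D * singWeight S x) volume (-R) R :=
    (intervalIntegrable_singWeight S _ _).const_mul D
  have hint : IntervalIntegrable G volume (-R) R := by
    refine hW.mono_fun' ?_ ?_
    -- `G` is measurable as an a.e. limit of continuous functions. The approximants must be
    -- measurable for every real `ε`, hence the value `0` for `ε ≤ 0`, where nothing is known about
    -- `F`.
    · refine (aestronglyMeasurable_of_tendsto_ae (𝓝[>] (0 : ℝ))
        (f := fun (ε : ℝ) (x : ℝ) => if 0 < ε then F (x + ε * Complex.I) else 0)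
        (fun ε => ?_) ?_ : AEStronglyMeasurable G volume).restrict
      · by_cases h : 0 < ε
        · simpa [h] using (hcont ε h).aestronglyMeasurable
        · simpa [h] using aestronglyMeasurable_const
      · filter_upwards [hS] with x hx
        refine (hlim' x hx).congr' ?_
        filter_upwards [self_mem_nhdsWithin] with ε hε
        exact (if_pos hε).symm
    · filter_upwards [ae_restrict_of_ae hS, ae_restrict_mem measurableSet_uIoc] with x hx hx'
      refine le_of_tendsto (hlim' x hx).norm ?_
      filter_upwards [hIoo] with ε hε
      exact hbound ε hε x hx' hx
  refine ⟨hint, ?_⟩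
  have hT : Tendsto (fun ε : ℝ => ∫ x in -R..R, F (x + ε * Complex.I)) (𝓝[>] 0)
      (𝓝 (∫ x in -R..R, G x)) := by
    refine intervalIntegral.tendsto_integral_filter_of_dominated_convergence
      (fun x : ℝ => D * singWeight S x) ?_ ?_ hW ?_
    · filter_upwards [self_mem_nhdsWithin] with ε hε
      exact (hcont ε hε).aestronglyMeasurable.restrict
    · filter_upwards [hIoo] with ε hε
      filter_upwards [hS] with x hx hx'
      exact hbound ε hε x hx' hx
    · filter_upwards [hS] with x hx _
      exact hlim' x hx
  refine le_of_tendsto hT.norm ?_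
  filter_upwards [self_mem_nhdsWithin] with ε hε
  exact norm_integral_horizontal_le hF hdecay hC hR hR₀ hε

/-- A function on the upper half plane with quadratic decay, inverse square root singularities and
boundary values of nonnegative real part has boundary values of zero real part. -/
theorem boundary_re_eq_zero {F : ℂ → ℂ} {G : ℝ → ℂ} {S : Finset ℝ}
    (hF : DifferentiableOn ℂ F upperSet)
    {C R₀ : ℝ} (hdecay : ∀ z : ℂ, 0 < z.im → R₀ ≤ ‖z‖ → ‖F z‖ ≤ C / ‖z‖ ^ 2) (hC : 0 ≤ C)
    (hlim : ∀ x : ℝ, x ∉ S → Tendsto F (𝓝[upperSet] x) (𝓝 (G x)))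
    (hsing : ∀ s ∈ S, ∃ C, ∀ᶠ z in 𝓝[upperSet] (s : ℂ),
      ‖F z‖ ≤ C * ‖z - (s : ℂ)‖ ^ (-(1 / 2) : ℝ))
    (hpos : ∀ x : ℝ, x ∉ S → 0 ≤ (G x).re) {x : ℝ} (hx : x ∉ S) : (G x).re = 0 := by
  have hSopen : IsOpen ((S : Set ℝ)ᶜ) := S.finite_toSet.isClosed.isOpen_compl
  have hcont : ContinuousOn G (S : Set ℝ)ᶜ := by
    have h := continuousOn_extendFrom (f := F) (A := upperSet)
      (B := (fun x : ℝ => (x : ℂ)) '' (S : Set ℝ)ᶜ)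
      (by rintro _ ⟨x, _, rfl⟩; exact ofReal_mem_closure_upperSet x)
      (by rintro _ ⟨x, hx, rfl⟩; exact ⟨_, hlim x hx⟩)
    refine (h.comp Complex.continuous_ofReal.continuousOn (Set.mapsTo_image _ _)).congr ?_
    intro x hx
    exact (extendFrom_eq (ofReal_mem_closure_upperSet x) (hlim x hx)).symm
  by_contra hne
  have hgt : 0 < (G x).re := lt_of_le_of_ne (hpos x hx) (Ne.symm hne)
  have hcx : ContinuousAt (fun x => (G x).re) x :=
    Complex.continuous_re.continuousAt.comp (hcont.continuousAt (hSopen.mem_nhds hx))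
  set η := (G x).re / 2 with hη
  have hη0 : 0 < η := by positivity
  have hev : ∀ᶠ y in 𝓝 x, η < (G y).re := hcx.eventually (lt_mem_nhds (by linarith))
  obtain ⟨δ, hδ, hball⟩ := Metric.eventually_nhds_iff_ball.1 hev
  have hS : ∀ᵐ x : ℝ, x ∉ S :=
    measure_eq_zero_iff_ae_notMem.1 (S.finite_toSet.measure_zero volume)
  -- By nonnegativity, the integral over `[-R, R]` is at least the contribution of an interval of
  -- length `δ` about `x`, on which the real part exceeds `η`. The upper bound tends to `0`.
  have main : ∀ R : ℝ, max 1 R₀ ≤ R → |x| + δ ≤ R → η * δ ≤ 4 * C / R := by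
    intro R hR hxR
    obtain ⟨hint, hle⟩ := boundary_integral_bound hF hdecay hC hlim hsing
      (zero_lt_one.trans_le ((le_max_left _ _).trans hR)) ((le_max_right _ _).trans hR)
    have hx1 := neg_abs_le x
    have hx2 := le_abs_self x
    have hre : IntervalIntegrable (fun x => (G x).re) volume (-R) R := ⟨hint.1.re, hint.2.re⟩
    have hsub : IntervalIntegrable (fun x => (G x).re) volume (x - δ / 2) (x + δ / 2) :=
      hre.mono_set (by
        rw [Set.uIcc_of_le (by linarith), Set.uIcc_of_le (by linarith)]
        exact Set.Icc_subset_Icc (by linarith) (by linarith))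
    calc η * δ = ∫ _ in (x - δ / 2)..(x + δ / 2), η := by
          rw [intervalIntegral.integral_const, smul_eq_mul]; ring
      _ ≤ ∫ y in (x - δ / 2)..(x + δ / 2), (G y).re := by
          refine intervalIntegral.integral_mono_on (by linarith) intervalIntegrable_const hsub ?_
          intro y hy
          refine (hball y ?_).le
          rw [Real.ball_eq_Ioo]
          exact ⟨by linarith [hy.1], by linarith [hy.2]⟩
      _ ≤ ∫ y in -R..R, (G y).re := by
          refine intervalIntegral.integral_mono_interval (by linarith) (by linarith) (by linarith)
            ?_ hre
          filter_upwards [ae_restrict_of_ae hS] with y hy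
          exact hpos y hy
      _ = (∫ y in -R..R, G y).re := by
          have := Complex.reCLM.intervalIntegral_comp_comm hint
          simpa using this
      _ ≤ ‖∫ y in -R..R, G y‖ := (le_abs_self _).trans (Complex.abs_re_le_norm _)
      _ ≤ 4 * C / R := hle
  have hlim0 : Tendsto (fun R : ℝ => 4 * C / R) atTop (𝓝 0) :=
    tendsto_const_nhds.div_atTop tendsto_id
  have := ge_of_tendsto hlim0 (by
    filter_upwards [eventually_ge_atTop (max 1 R₀), eventually_ge_atTop (|x| + δ)] with R h1 h2
    exact main R h1 h2)
  nlinarith [mul_pos hη0 hδ]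

/-! ### The root, the gauge matrix and the conserved form -/

theorem rootL_sq (A : ℝ) (z : ℂ) : rootL A z ^ 2 = z ^ 2 - (1 / A ^ 2 : ℝ) := by
  have h : ∀ w : ℂ, (w ^ (1 / 2 : ℂ)) ^ 2 = w := fun w => by
    rw [← Complex.cpow_ofNat_mul]; simp
  rw [rootL, mul_pow, h, h]
  push_cast
  ring

theorem cpow_half_of_nonneg {x : ℝ} (hx : 0 ≤ x) :
    (x : ℂ) ^ (1 / 2 : ℂ) = (Real.sqrt x : ℝ) := by
  rw [Real.sqrt_eq_rpow, Complex.ofReal_cpow hx]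
  norm_num

theorem cpow_half_of_neg {x : ℝ} (hx : x < 0) :
    (x : ℂ) ^ (1 / 2 : ℂ) = Complex.I * (Real.sqrt (-x) : ℝ) := by
  have h : (Complex.I) = Complex.exp (Real.pi * Complex.I * (1 / 2)) := by
    rw [show (Real.pi * Complex.I * (1 / 2) : ℂ) = Real.pi / 2 * Complex.I by ring,
      Complex.exp_pi_div_two_mul_I]
  rw [Complex.ofReal_cpow_of_nonpos hx.le, ← Complex.ofReal_neg,
    cpow_half_of_nonneg (by linarith), ← h, mul_comm]

/-- Outside the cut the root is real with the sign of the argument. -/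
theorem exists_rootL_eq_of_mem_sigmaDot {A lam : ℝ} (hA : 0 < A) (h : lam ∈ sigmaDot A) :
    ∃ l : ℝ, rootL A lam = l ∧ 0 < l * lam := by
  have hA' : 0 < 1 / A := by positivity
  have h' : 1 / A < |lam| := h
  unfold rootL
  rw [← Complex.ofReal_sub, ← Complex.ofReal_add]
  rcases lt_abs.1 h' with h1 | h1
  · rw [cpow_half_of_nonneg (by linarith), cpow_half_of_nonneg (by linarith)]
    refine ⟨_, (Complex.ofReal_mul _ _).symm, ?_⟩
    have := Real.sqrt_pos.2 (show 0 < lam - 1 / A by linarith)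
    have := Real.sqrt_pos.2 (show 0 < lam + 1 / A by linarith)
    have : 0 < lam := by linarith
    positivity
  · rw [cpow_half_of_neg (by linarith), cpow_half_of_neg (by linarith)]
    refine ⟨-(Real.sqrt (-(lam - 1 / A)) * Real.sqrt (-(lam + 1 / A))), ?_, ?_⟩
    · push_cast
      linear_combination (Real.sqrt (-(lam - 1 / A)) : ℂ) * Real.sqrt (-(lam + 1 / A)) *
        Complex.I_sq
    · have h1 := Real.sqrt_pos.2 (show 0 < -(lam - 1 / A) by linarith)
      have h2 := Real.sqrt_pos.2 (show 0 < -(lam + 1 / A) by linarith)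
      have h3 : 0 < -lam := by linarith
      have := mul_pos (mul_pos h1 h2) h3
      linarith

/-- On the cut the root is purely imaginary, in the upper half plane. -/
theorem exists_rootL_eq_of_abs_lt {A lam : ℝ} (h : |lam| < 1 / A) :
    ∃ k : ℝ, 0 < k ∧ rootL A lam = Complex.I * k := by
  obtain ⟨h1, h2⟩ := abs_lt.1 h
  unfold rootL
  rw [← Complex.ofReal_sub, ← Complex.ofReal_add, cpow_half_of_neg (by linarith),
    cpow_half_of_nonneg (by linarith)]
  have h3 := Real.sqrt_pos.2 (show 0 < -(lam - 1 / A) by linarith)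
  have h4 := Real.sqrt_pos.2 (show 0 < lam + 1 / A by linarith)
  exact ⟨_, mul_pos h3 h4, by push_cast; ring⟩

theorem sqrtCut_sq (z : ℂ) : sqrtCut z ^ 2 = z := by
  rw [sqrtCut, mul_pow, ← Complex.cpow_ofNat_mul, Complex.I_sq]; simp

/-- The gauge transformation turns the invariant form `2 Im(v₀ v̄₁)` into `|w₀|² - |w₁|²`. -/
theorem normSq_gaugeH_mulVec {A lam : ℝ} (hA : 0 < A) (h : lam ∈ sigmaDot A) (v : Fin 2 → ℂ) :
    Complex.normSq ((gaugeH A lam).mulVec v 0) - Complex.normSq ((gaugeH A lam).mulVec v 1) =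
      2 * (v 0 * (starRingEnd ℂ) (v 1)).im := by
  obtain ⟨l, hl, hpos⟩ := exists_rootL_eq_of_mem_sigmaDot hA h
  have hsq : l ^ 2 = lam ^ 2 - 1 / A ^ 2 := by
    have := rootL_sq A lam
    rw [hl] at this
    exact_mod_cast this
  have hl0 : l ≠ 0 := by rintro rfl; simp at hpos
  have hlam : lam ≠ 0 := by rintro rfl; simp at hpos
  have hAl : lam ^ 2 * A ^ 2 = 1 + A ^ 2 * l ^ 2 := by rw [hsq]; field_simp; ring
  have hD : (1 : ℂ) - Complex.I * A * l ≠ 0 := fun h0 => by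
    have := congrArg Complex.re h0
    simp at this
  set s : ℂ := ((Real.sqrt (1 / 2) : ℝ) : ℂ) * sqrtCut (1 / (Complex.I * A * l) - 1) with hs
  set α : ℂ := lam * A / (1 - Complex.I * A * l) with hα
  have hα' : α = ((lam * A / (lam ^ 2 * A ^ 2) : ℝ) : ℂ) * (1 + Complex.I * ((A * l : ℝ) : ℂ)) := by
    rw [hα, div_eq_iff hD]
    have hA0 : (A : ℂ) ≠ 0 := by exact_mod_cast hA.ne'
    have hlam0 : (lam : ℂ) ≠ 0 := by exact_mod_cast hlam
    have hAlc : (lam : ℂ) ^ 2 * A ^ 2 = 1 + A ^ 2 * l ^ 2 := by exact_mod_cast hAl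
    push_cast
    field_simp
    linear_combination hAlc + (A : ℂ) ^ 2 * l ^ 2 * Complex.I_sq
  have hαre : α.re = lam * A / (lam ^ 2 * A ^ 2) := by
    rw [hα']; simp [-Complex.ofReal_mul, -Complex.ofReal_div, -Complex.ofReal_pow]
  have hαim : α.im = lam * A / (lam ^ 2 * A ^ 2) * (A * l) := by
    rw [hα']; simp [-Complex.ofReal_mul, -Complex.ofReal_div, -Complex.ofReal_pow]
  -- Since λ²A² = 1 + A²l² = |1 - iAl|², the diagonal ratio α is unimodular.
  have hα1 : α.re ^ 2 + α.im ^ 2 = 1 := by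
    rw [hαre, hαim]
    field_simp
    linear_combination -hAl
  -- Here |s|² = |λ|/(2|l|) and Im α = l/λ; the absolute values drop because `l` has the sign of λ.
  have hs2 : Complex.normSq s * α.im = 1 / 2 := by
    have e1 : Complex.normSq s ^ 2 = (1 / 2 * (|lam| / |l|)) ^ 2 := by
      have e : s ^ 2 = 1 / 2 * (1 / (Complex.I * A * l) - 1) := by
        rw [hs, mul_pow, sqrtCut_sq, ← Complex.ofReal_pow, Real.sq_sqrt (by norm_num)]
        norm_num
      rw [← map_pow, e]
      have e' : (1 / (Complex.I * A * l) - 1 : ℂ) = ⟨-1, -(1 / (A * l))⟩ := by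
        have hA0 : (A : ℂ) ≠ 0 := by exact_mod_cast hA.ne'
        have hl0' : (l : ℂ) ≠ 0 := by exact_mod_cast hl0
        rw [Complex.mk_eq_add_mul_I]
        push_cast
        field_simp
        linear_combination Complex.I_sq
      rw [e', Complex.normSq_mul]
      have : Complex.normSq (1 / 2) = 1 / 4 := by
        rw [Complex.normSq_apply]; norm_num
      rw [this, Complex.normSq_mk, mul_pow, div_pow |lam|, sq_abs, sq_abs]
      field_simp
      linear_combination -4 * hAl
    have e2 : Complex.normSq s = 1 / 2 * (|lam| / |l|) :=
      (sq_eq_sq₀ (Complex.normSq_nonneg _) (by positivity)).1 e1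
    have e3 : |lam| / |l| = lam / l := by
      rw [← abs_div, abs_of_pos]
      have : lam / l = l * lam / l ^ 2 := by field_simp
      rw [this]
      positivity
    rw [e2, e3, hαim]
    field_simp
  have c0 : (gaugeH A lam).mulVec v 0 = s * (α * v 0 - v 1) := by
    simp [gaugeH, hl, Matrix.mulVec, dotProduct, Fin.sum_univ_two, hs, hα]; ring
  have c1 : (gaugeH A lam).mulVec v 1 = s * (α * v 1 - v 0) := by
    simp [gaugeH, hl, Matrix.mulVec, dotProduct, Fin.sum_univ_two, hs, hα]; ring
  rw [c0, c1, Complex.normSq_mul s, Complex.normSq_mul s, ← mul_sub]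
  have : Complex.normSq (α * v 0 - v 1) - Complex.normSq (α * v 1 - v 0) =
      4 * α.im * (v 0 * (starRingEnd ℂ) (v 1)).im := by
    simp only [Complex.normSq_apply, Complex.sub_re, Complex.sub_im, Complex.mul_re,
      Complex.mul_im, Complex.conj_re, Complex.conj_im]
    linear_combination ((v 0).re ^ 2 + (v 0).im ^ 2 - (v 1).re ^ 2 - (v 1).im ^ 2) * hα1
  rw [this]
  linear_combination 4 * (v 0 * (starRingEnd ℂ) (v 1)).im * hs2

/-- The form `Im(ψ₀ ψ̄₁)` is constant along solutions of the Lax equation with real parameter. -/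
theorem IsLaxSolution.im_const {m₀ : ℝ → ℝ} {lam : ℝ} {ψ : ℝ → Fin 2 → ℂ}
    (h : IsLaxSolution m₀ lam ψ) (x x' : ℝ) :
    (ψ x 0 * (starRingEnd ℂ) (ψ x 1)).im = (ψ x' 0 * (starRingEnd ℂ) (ψ x' 1)).im := by
  refine is_const_of_deriv_eq_zero (f := fun x => (ψ x 0 * (starRingEnd ℂ) (ψ x 1)).im)
    (fun x => ?_) (fun x => ?_) x x'
  all_goals
    have h0 := hasDerivAt_pi.1 (h x)
    have h1 := (h0 0).mul (h0 1).star
    have h2 := (Complex.imCLM.hasFDerivAt.comp_hasDerivAt x h1)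
  · exact h2.differentiableAt
  · refine h2.deriv.trans ?_
    -- The diagonal entries ∓1/2 cancel in (ψ₀ψ̄₁)', leaving (λm₀/2)(|ψ₁|² - |ψ₀|²), which is real.
    simp [laxU, Matrix.mulVec, dotProduct, Fin.sum_univ_two]
    ring

theorem det_gaugeH {A : ℝ} {z : ℂ} (hA : A ≠ 0) (hl : rootL A z ≠ 0)
    (h1 : 1 - Complex.I * A * rootL A z ≠ 0) : (gaugeH A z).det = 1 := by
  have hsq : z ^ 2 * A ^ 2 = 1 + A ^ 2 * rootL A z ^ 2 := by
    have hA' : (A : ℂ) ≠ 0 := by exact_mod_cast hA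
    rw [rootL_sq]
    push_cast
    field_simp
    ring
  have hA' : (A : ℂ) ≠ 0 := by exact_mod_cast hA
  have e : (((Real.sqrt (1 / 2) : ℝ) : ℂ) *
      sqrtCut (1 / (Complex.I * A * rootL A z) - 1)) ^ 2 =
      1 / 2 * (1 / (Complex.I * A * rootL A z) - 1) := by
    rw [mul_pow, sqrtCut_sq, ← Complex.ofReal_pow, Real.sq_sqrt (by norm_num)]
    norm_num
  rw [gaugeH, Matrix.det_smul, Fintype.card_fin, e, Matrix.det_fin_two_of]
  generalize rootL A z = l at *
  have hI := Complex.I_ne_zero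
  field_simp
  linear_combination hsq + A ^ 2 * l ^ 2 * Complex.I_sq

/-! ### Modulus of the reflection coefficient -/

theorem exists_phaseRight_eq {A lam : ℝ} (hA : 0 < A) (h : lam ∈ sigmaDot A) (m₀ : ℝ → ℝ) (x : ℝ) :
    ∃ θ : ℝ, phaseRight A m₀ x lam = θ * Complex.I := by
  obtain ⟨l, hl, -⟩ := exists_rootL_eq_of_mem_sigmaDot hA h
  rw [phaseRight, hl]
  exact ⟨A * l * (1 / (2 * A) * (-∫ ξ in Set.Ioi x, (m₀ ξ - A)) + x / 2), by push_cast; ring⟩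

theorem exists_phaseLeft_eq {A lam : ℝ} (hA : 0 < A) (h : lam ∈ sigmaDot A) (m₀ : ℝ → ℝ) (x : ℝ) :
    ∃ θ : ℝ, phaseLeft A m₀ x lam = θ * Complex.I := by
  obtain ⟨l, hl, -⟩ := exists_rootL_eq_of_mem_sigmaDot hA h
  rw [phaseLeft, hl]
  exact ⟨A * l * (1 / (2 * A) * (∫ ξ in Set.Iic x, (m₀ ξ - A)) + x / 2), by push_cast; ring⟩

theorem tendsto_norm_of_unimodular_mul {l : Filter ℝ} {E a : ℝ → ℂ} {p : ℂ}
    (hE : ∀ x, ‖E x‖ = 1) (ha : Tendsto (fun x => E x * a x) l (𝓝 p)) :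
    Tendsto (fun x => ‖a x‖) l (𝓝 ‖p‖) := by
  simpa [hE] using ha.norm

/-- The two right Jost columns carry opposite oscillating phases. In each component only one column
survives in the limit, so its phase is an overall unimodular factor invisible to the modulus. -/
theorem tendsto_normSq_combination {l : Filter ℝ} {E a b : ℝ → ℂ} {p : ℂ} (c d : ℂ)
    (hE : ∀ x, ‖E x‖ = 1) (ha : Tendsto (fun x => E x * a x) l (𝓝 p))
    (hb : Tendsto (fun x => ‖b x‖) l (𝓝 0)) :
    Tendsto (fun x => Complex.normSq (c * a x + d * b x)) l (𝓝 (Complex.normSq (c * p))) := by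
  have hb' : Tendsto (fun x => E x * b x) l (𝓝 0) := by
    rw [tendsto_zero_iff_norm_tendsto_zero]
    simpa [hE] using hb
  have h : Tendsto (fun x => E x * (c * a x + d * b x)) l (𝓝 (c * p)) := by
    have := (ha.const_mul c).add (hb'.const_mul d)
    rw [mul_zero, add_zero] at this
    exact this.congr fun x => by ring
  simp only [Complex.normSq_eq_norm_sq]
  exact (tendsto_norm_of_unimodular_mul hE h).pow 2

/-- The conserved form is evaluated at +∞, where the gauge turns it into a difference of squared
moduli of the two components. -/
theorem im_eq_of_jostRight {A lam : ℝ} (hA : 0 < A) (h : lam ∈ sigmaDot A) {m₀ : ℝ → ℝ}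
    {ψ φ₁ φ₂ : ℝ → Fin 2 → ℂ} {c₁ c₂ : ℂ} (hψ : IsLaxSolution m₀ lam ψ)
    (h₁ : IsJostRightFst A m₀ lam φ₁) (h₂ : IsJostRightSnd A m₀ lam φ₂)
    (hc : ∀ x, ψ x = c₁ • φ₁ x + c₂ • φ₂ x) (x : ℝ) :
    2 * (ψ x 0 * (starRingEnd ℂ) (ψ x 1)).im = ‖c₁‖ ^ 2 - ‖c₂‖ ^ 2 := by
  have hE : ∀ x, ‖Complex.exp (phaseRight A m₀ x lam)‖ = 1 := fun x => by
    obtain ⟨θ, hθ⟩ := exists_phaseRight_eq hA h m₀ x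
    rw [hθ, Complex.norm_exp_ofReal_mul_I]
  have hE' : ∀ x, ‖Complex.exp (-phaseRight A m₀ x lam)‖ = 1 := fun x => by
    rw [Complex.exp_neg, norm_inv, hE, inv_one]
  have a0 := tendsto_pi_nhds.1 h₁.2 0
  have a1 := tendsto_pi_nhds.1 h₁.2 1
  have b0 := tendsto_pi_nhds.1 h₂.2 0
  have b1 := tendsto_pi_nhds.1 h₂.2 1
  simp only [Pi.smul_apply, smul_eq_mul, Matrix.cons_val_zero, Matrix.cons_val_one] at a0 a1 b0 b1
  have b0' := tendsto_norm_of_unimodular_mul hE' b0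
  have a1' := tendsto_norm_of_unimodular_mul hE a1
  rw [norm_zero] at b0' a1'
  have t0 := tendsto_normSq_combination c₁ c₂ hE a0 b0'
  -- In the second component `φ₂` survives, so the two columns exchange roles.
  have t1 := tendsto_normSq_combination c₂ c₁ hE' b1 a1'
  have t := t0.sub t1
  rw [mul_one, mul_one, Complex.normSq_eq_norm_sq, Complex.normSq_eq_norm_sq] at t
  refine tendsto_nhds_unique (f := fun _ : ℝ => 2 * (ψ x 0 * (starRingEnd ℂ) (ψ x 1)).im)
    (l := atTop) tendsto_const_nhds (t.congr fun x' => ?_)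
  rw [hψ.im_const x x', ← normSq_gaugeH_mulVec hA h, hc x', Matrix.mulVec_add,
    Matrix.mulVec_smul, Matrix.mulVec_smul]
  simp only [Pi.add_apply, Pi.smul_apply, smul_eq_mul]
  rw [add_comm (c₂ * _)]

theorem im_eq_of_jostLeft {A lam : ℝ} (hA : 0 < A) (h : lam ∈ sigmaDot A) {m₀ : ℝ → ℝ}
    {ψ : ℝ → Fin 2 → ℂ} (hψ : IsJostLeftFst A m₀ lam ψ) (x : ℝ) :
    2 * (ψ x 0 * (starRingEnd ℂ) (ψ x 1)).im = 1 := by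
  have hE : ∀ x, ‖Complex.exp (phaseLeft A m₀ x lam)‖ = 1 := fun x => by
    obtain ⟨θ, hθ⟩ := exists_phaseLeft_eq hA h m₀ x
    rw [hθ, Complex.norm_exp_ofReal_mul_I]
  have a0 := tendsto_pi_nhds.1 hψ.2 0
  have a1 := tendsto_pi_nhds.1 hψ.2 1
  simp only [Pi.smul_apply, smul_eq_mul, Matrix.cons_val_zero, Matrix.cons_val_one] at a0 a1
  have t := ((tendsto_norm_of_unimodular_mul hE a0).pow 2).sub
    ((tendsto_norm_of_unimodular_mul hE a1).pow 2)
  rw [norm_one, norm_zero, one_pow, zero_pow two_ne_zero, sub_zero] at t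
  refine tendsto_nhds_unique (f := fun _ : ℝ => 2 * (ψ x 0 * (starRingEnd ℂ) (ψ x 1)).im)
    (l := atBot) tendsto_const_nhds (t.congr fun x' => ?_)
  rw [hψ.1.im_const x x', ← normSq_gaugeH_mulVec hA h, Complex.normSq_eq_norm_sq,
    Complex.normSq_eq_norm_sq]

/-- On the cut `l = ik` with `k > 0`, so the exponent is real; it tends to -∞ like `A k x / 2`, as
the integral term is bounded by an L¹ norm. -/
theorem tendsto_exp_neg_phaseLeft {A lam : ℝ} (hA : 0 < A) (h : |lam| < 1 / A) {m₀ : ℝ → ℝ}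
    (hm₀ : IntegrableOn (fun x => m₀ x - A) (Set.Iic 0)) :
    Tendsto (fun x => Complex.exp (-phaseLeft A m₀ x lam)) atBot (𝓝 0) := by
  obtain ⟨k, hk, hl⟩ := exists_rootL_eq_of_abs_lt h
  have hX : Tendsto (fun x : ℝ => 1 / (2 * A) * (∫ ξ in Set.Iic x, (m₀ ξ - A)) + x / 2)
      atBot atBot := by
    refine tendsto_atBot_add_left_of_ge' (C := 1 / (2 * A) * ∫ ξ in Set.Iic 0, ‖m₀ ξ - A‖) atBot ?_
      (tendsto_id.atBot_div_const two_pos)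
    filter_upwards [eventually_le_atBot 0] with x hx
    gcongr
    refine (Real.le_norm_self _).trans ((norm_integral_le_integral_norm _).trans ?_)
    exact setIntegral_mono_set hm₀.norm (ae_of_all _ fun _ => norm_nonneg _)
      (Set.Iic_subset_Iic.2 hx).eventuallyLE
  have : Tendsto (fun x : ℝ => Real.exp (A * k *
      (1 / (2 * A) * (∫ ξ in Set.Iic x, (m₀ ξ - A)) + x / 2))) atBot (𝓝 0) :=
    Real.tendsto_exp_atBot.comp (hX.const_mul_atBot (by positivity))
  have := (Complex.continuous_ofReal.tendsto 0).comp this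
  rw [Complex.ofReal_zero] at this
  refine this.congr fun x => ?_
  rw [Function.comp_apply, Complex.ofReal_exp, phaseLeft, hl]
  congr 1
  generalize 1 / (2 * A) * (∫ ξ in Set.Iic x, (m₀ ξ - A)) + x / 2 = X
  push_cast
  linear_combination (A : ℂ) * k * X * Complex.I_sq

/-- The normalization and the invertibility of the gauge matrix make ψ decay at -∞, so the conserved
form has limit zero. -/
theorem im_eq_zero_of_jostLeft {A lam : ℝ} (hA : 0 < A) (h : |lam| < 1 / A) {m₀ : ℝ → ℝ}
    (hm₀ : IntegrableOn (fun x => m₀ x - A) (Set.Iic 0))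
    {ψ : ℝ → Fin 2 → ℂ} (hψ : IsJostLeftFst A m₀ lam ψ) (x : ℝ) :
    (ψ x 0 * (starRingEnd ℂ) (ψ x 1)).im = 0 := by
  obtain ⟨k, hk, hl⟩ := exists_rootL_eq_of_abs_lt h
  have hdet : (gaugeH A lam).det = 1 := by
    refine det_gaugeH hA.ne' ?_ ?_
    · rw [hl]
      exact mul_ne_zero Complex.I_ne_zero (by exact_mod_cast hk.ne')
    · rw [hl]
      have : (1 : ℂ) - Complex.I * A * (Complex.I * k) = ((1 + A * k : ℝ) : ℂ) := by
        push_cast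
        linear_combination -(A : ℂ) * k * Complex.I_sq
      rw [this]
      exact_mod_cast (by positivity : 1 + A * k ≠ 0)
  have t1 : Tendsto (fun x => (gaugeH A lam).mulVec (ψ x)) atBot (𝓝 0) := by
    have := (tendsto_exp_neg_phaseLeft hA h hm₀).smul hψ.2
    rw [zero_smul] at this
    refine this.congr fun x => ?_
    rw [smul_smul, ← Complex.exp_add, neg_add_cancel, Complex.exp_zero, one_smul]
  have t2 : Tendsto ψ atBot (𝓝 0) := by
    have hc : Continuous fun v : Fin 2 → ℂ => (gaugeH A lam)⁻¹.mulVec v := by fun_prop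
    have := (hc.tendsto 0).comp t1
    rw [Matrix.mulVec_zero] at this
    refine this.congr fun x => ?_
    rw [Function.comp_apply, Matrix.mulVec_mulVec, Matrix.nonsing_inv_mul _ (by simp [hdet]),
      Matrix.one_mulVec]
  have hc : Continuous fun v : Fin 2 → ℂ => (v 0 * (starRingEnd ℂ) (v 1)).im :=
    Complex.continuous_im.comp ((continuous_apply 0).mul
      (Complex.continuous_conj.comp (continuous_apply 1)))
  have t3 := (hc.tendsto 0).comp t2
  refine tendsto_nhds_unique (f := fun _ : ℝ => (ψ x 0 * (starRingEnd ℂ) (ψ x 1)).im)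
    (l := atBot) tendsto_const_nhds ?_
  simp only [Pi.zero_apply, zero_mul, Complex.zero_im] at t3
  exact t3.congr fun x' => hψ.1.im_const x' x

theorem IsReflectionCoefficient.norm_lt_one {A₁ A₂ : ℝ} (hA₁ : 0 < A₁) (hA : A₁ < A₂) {u₀ : ℝ → ℝ}
    {r : ℝ → ℂ} (hr : IsReflectionCoefficient A₁ A₂ u₀ r) {lam : ℝ} (h : lam ∈ sigmaDot A₁) :
    ‖r lam‖ < 1 := by
  obtain ⟨ψ, φ₁, φ₂, c₁, c₂, hψ, h₁, h₂, hc, hrl⟩ := hr lam (Or.inl h)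
  have h' : lam ∈ sigmaDot A₂ := (one_div_lt_one_div_of_lt hA₁ hA).trans h
  have e1 := im_eq_of_jostRight (hA₁.trans hA) h' hψ.1 h₁ h₂ hc 0
  rw [im_eq_of_jostLeft hA₁ h hψ] at e1
  have hpos : 0 < ‖c₁‖ := norm_pos_iff.2 fun h0 => by
    rw [h0, norm_zero] at e1
    nlinarith [sq_nonneg ‖c₂‖]
  rw [hrl, norm_div, div_lt_one hpos]
  nlinarith [norm_nonneg c₂]

theorem IsReflectionCoefficient.norm_eq_one {A₁ A₂ : ℝ} (hA₁ : 0 < A₁) (hA : A₁ < A₂) {u₀ : ℝ → ℝ}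
    (hu₀ : IsStepLike A₁ A₂ u₀) {r : ℝ → ℂ} (hr : IsReflectionCoefficient A₁ A₂ u₀ r) {lam : ℝ}
    (h : lam ∈ sigmaZeroDot A₁ A₂) : ‖r lam‖ = 1 := by
  obtain ⟨ψ, φ₁, φ₂, c₁, c₂, hψ, h₁, h₂, hc, hrl⟩ := hr lam (Or.inr h)
  have e1 := im_eq_of_jostRight (hA₁.trans hA) h.1 hψ.1 h₁ h₂ hc 0
  rw [im_eq_zero_of_jostLeft hA₁ h.2 hu₀.integrable_left hψ, mul_zero, eq_comm, sub_eq_zero,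
    sq_eq_sq₀ (norm_nonneg _) (norm_nonneg _)] at e1
  -- If `c₁` vanished, so would `c₂`, and the left Jost solution would be zero, against its
  -- normalization.
  have hne : ‖c₁‖ ≠ 0 := fun h0 => by
    have hc1 : c₁ = 0 := norm_eq_zero.1 h0
    have hc2 : c₂ = 0 := norm_eq_zero.1 (e1 ▸ h0)
    have hψ0 : ∀ x, ψ x = 0 := fun x => by rw [hc x, hc1, hc2, zero_smul, zero_smul, add_zero]
    have ht := tendsto_pi_nhds.1 hψ.2 0
    simp only [hψ0, Matrix.mulVec_zero, smul_zero, Pi.zero_apply, Matrix.cons_val_zero] at ht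
    exact zero_ne_one (tendsto_nhds_unique tendsto_const_nhds ht)
  rw [hrl, norm_div, ← e1, div_self hne]

/-! ### Boundary uniqueness -/

/-- A function analytic in a square and zero on its upper side vanishes at the centre: the product of
its four rotations about the centre is zero on the whole boundary. -/
theorem eq_zero_of_square {f : ℂ → ℂ} {x δ : ℝ} (hδ : 0 < δ)
    (hc : ContinuousOn f (Set.Icc (x - δ) (x + δ) ×ℂ Set.Icc (-2 * δ) 0))
    (hd : DifferentiableOn ℂ f (Set.Ioo (x - δ) (x + δ) ×ℂ Set.Ioo (-2 * δ) 0))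
    (h0 : ∀ s ∈ Set.Icc (x - δ) (x + δ), f s = 0) : f (x - δ * Complex.I) = 0 := by
  set c : ℂ := x - δ * Complex.I with hcdef
  set U : Set ℂ := Set.Ioo (-δ) δ ×ℂ Set.Ioo (-δ) δ with hU
  have hUcl : closure U = Set.Icc (-δ) δ ×ℂ Set.Icc (-δ) δ := by
    rw [hU, Complex.closure_reProdIm, closure_Ioo (by linarith)]
  set g : ℂ → ℂ := fun z => f (c + z) * f (c + Complex.I * z) * f (c + -z) * f (c + -Complex.I * z)
    with hg
  have hcre : c.re = x := by simp [hcdef]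
  have hcim : c.im = -δ := by simp [hcdef]
  have mapU : ∀ z ∈ U, c + z ∈ Set.Ioo (x - δ) (x + δ) ×ℂ Set.Ioo (-2 * δ) 0 := by
    rintro z ⟨⟨h1, h2⟩, h3, h4⟩
    refine ⟨⟨?_, ?_⟩, ?_, ?_⟩ <;> simp only [Complex.add_re, Complex.add_im, hcre, hcim] <;> linarith
  have mapC : ∀ z ∈ closure U, c + z ∈ Set.Icc (x - δ) (x + δ) ×ℂ Set.Icc (-2 * δ) 0 := by
    rw [hUcl]
    rintro z ⟨⟨h1, h2⟩, h3, h4⟩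
    refine ⟨⟨?_, ?_⟩, ?_, ?_⟩ <;> simp only [Complex.add_re, Complex.add_im, hcre, hcim] <;> linarith
  have rotU : ∀ z ∈ U, Complex.I * z ∈ U := by
    rintro z ⟨⟨h1, h2⟩, h3, h4⟩
    refine ⟨⟨?_, ?_⟩, ?_, ?_⟩ <;> simp <;> linarith
  have rotC : ∀ z ∈ closure U, Complex.I * z ∈ closure U := by
    rw [hUcl]
    rintro z ⟨⟨h1, h2⟩, h3, h4⟩
    refine ⟨⟨?_, ?_⟩, ?_, ?_⟩ <;> simp <;> linarith
  have negU : ∀ z ∈ U, -z ∈ U := fun z hz => by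
    have := rotU _ (rotU z hz)
    rwa [← mul_assoc, Complex.I_mul_I, neg_one_mul] at this
  have negC : ∀ z ∈ closure U, -z ∈ closure U := fun z hz => by
    have := rotC _ (rotC z hz)
    rwa [← mul_assoc, Complex.I_mul_I, neg_one_mul] at this
  have rotU' : ∀ z ∈ U, -Complex.I * z ∈ U := fun z hz => by
    rw [neg_mul]; exact negU _ (rotU z hz)
  have rotC' : ∀ z ∈ closure U, -Complex.I * z ∈ closure U := fun z hz => by
    rw [neg_mul]; exact negC _ (rotC z hz)
  have hgd : DiffContOnCl ℂ g U := by
    constructor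
    · exact (((hd.comp (by fun_prop) fun z hz => mapU z hz).mul
        (hd.comp (by fun_prop) fun z hz => mapU _ (rotU z hz))).mul
        (hd.comp (by fun_prop) fun z hz => mapU _ (negU z hz))).mul
        (hd.comp (by fun_prop) fun z hz => mapU _ (rotU' z hz))
    · exact (((hc.comp (by fun_prop) fun z hz => mapC z hz).mul
        (hc.comp (by fun_prop) fun z hz => mapC _ (rotC z hz))).mul
        (hc.comp (by fun_prop) fun z hz => mapC _ (negC z hz))).mul
        (hc.comp (by fun_prop) fun z hz => mapC _ (rotC' z hz))
  have top : ∀ w : ℂ, w ∈ closure U → w.im = δ → f (c + w) = 0 := by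
    intro w hw hi
    have e : c + w = ((x + w.re : ℝ) : ℂ) := by
      apply Complex.ext <;> simp [hcre, hcim, hi]
    rw [e]
    refine h0 _ ?_
    have := (mapC w hw).1
    rwa [Set.mem_preimage, Complex.add_re, hcre] at this
  have hfr : ∀ z ∈ frontier U, ‖g z‖ ≤ 0 := by
    intro z hz
    have hzc := frontier_subset_closure hz
    rw [hU, Complex.frontier_reProdIm, frontier_Ioo (by linarith)] at hz
    rw [norm_le_zero_iff]
    rcases hz with ⟨-, hz⟩ | ⟨hz, -⟩
    · rcases hz with hz | hz
      · simp only [hg]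
        rw [top (-z) (negC z hzc) (by rw [Complex.neg_im, hz, neg_neg])]
        ring
      · simp only [hg]
        rw [top z hzc hz]
        ring
    · rcases hz with hz | hz
      · simp only [hg]
        rw [top (-Complex.I * z) (rotC' z hzc) (by simp [hz])]
        ring
      · simp only [hg]
        rw [top (Complex.I * z) (rotC z hzc) (by
          have : z.re = δ := hz
          simp [this])]
        ring
  have hz0 : (0 : ℂ) ∈ closure U := by
    rw [hUcl]; exact ⟨⟨by simp [hδ.le], by simp [hδ.le]⟩, by simp [hδ.le], by simp [hδ.le]⟩
  have hb : Bornology.IsBounded U := (Metric.isBounded_Ioo _ _).reProdIm (Metric.isBounded_Ioo _ _)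
  have := Complex.norm_le_of_forall_mem_frontier_norm_le hb hgd hfr hz0
  rw [norm_le_zero_iff] at this
  simpa [hg] using this

/-- Boundary uniqueness: an analytic function on the lower half plane with zero boundary values on a
real interval vanishes. -/
theorem eq_zero_of_boundary_eq_zero {f : ℂ → ℂ} {a b : ℝ} (hab : a < b)
    (hf : DifferentiableOn ℂ f {z : ℂ | z.im < 0})
    (hlim : ∀ x ∈ Set.Ioo a b, Tendsto f (𝓝[{z : ℂ | z.im < 0}] (x : ℂ)) (𝓝 0))
    {z : ℂ} (hz : z.im < 0) : f z = 0 := by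
  have hopen : IsOpen {z : ℂ | z.im < 0} := isOpen_lt Complex.continuous_im continuous_const
  -- Extension by zero is continuous across the interval and supplies boundary values for `f`, whose
  -- own values on the axis are arbitrary.
  set F : ℂ → ℂ := Set.indicator {z : ℂ | z.im < 0} f with hF
  have hFd : DifferentiableOn ℂ F {z : ℂ | z.im < 0} :=
    hf.congr fun z hz => Set.indicator_of_mem hz f
  have hFc : ContinuousOn F {z : ℂ | z.re ∈ Set.Ioo a b} := by
    intro w hw
    refine ContinuousAt.continuousWithinAt ?_
    rcases lt_trichotomy w.im 0 with h | h | h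
    · exact (hFd.differentiableAt (hopen.mem_nhds h)).continuousAt
    · obtain ⟨x, rfl⟩ : ∃ x : ℝ, (x : ℂ) = w := ⟨w.re, Complex.ext (by simp) (by simp [h])⟩
      have hx : F x = 0 := Set.indicator_of_notMem (by simp) f
      rw [ContinuousAt, hx, ← nhdsWithin_univ, ← Set.union_compl_self {z : ℂ | z.im < 0},
        nhdsWithin_union]
      refine Tendsto.sup ((hlim x (by simpa using hw)).congr' ?_) (tendsto_const_nhds.congr' ?_)
      · filter_upwards [self_mem_nhdsWithin] with v hv
        exact (Set.indicator_of_mem (show v ∈ {z : ℂ | z.im < 0} from hv) f).symm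
      · filter_upwards [self_mem_nhdsWithin] with v hv
        exact (Set.indicator_of_notMem (show v ∉ {z : ℂ | z.im < 0} from hv) f).symm
    · have hev : (fun _ => (0 : ℂ)) =ᶠ[𝓝 w] F := by
        filter_upwards [(isOpen_lt continuous_const Complex.continuous_im).mem_nhds h] with v hv
        exact (Set.indicator_of_notMem
          (show v ∉ {z : ℂ | z.im < 0} from not_lt.2 (le_of_lt hv)) f).symm
      exact continuousAt_const.congr hev
  set x₀ : ℝ := (a + b) / 2 with hx₀
  -- A quarter of the length: a square centred at `w` with upper side on the axis has half-side
  -- below `η`, so that side stays within `2η` of the midpoint, inside `(a, b)`.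
  set η : ℝ := (b - a) / 4 with hη
  have hη0 : 0 < η := by rw [hη]; linarith
  have hzero : ∀ w ∈ Set.Ioo (x₀ - η) (x₀ + η) ×ℂ Set.Ioo (-η) 0, f w = 0 := by
    rintro w ⟨⟨h1, h2⟩, h3, h4⟩
    have hsub : ∀ s ∈ Set.Icc (w.re - -w.im) (w.re + -w.im), s ∈ Set.Ioo a b := by
      rintro s ⟨hs1, hs2⟩
      constructor <;> linarith
    have := eq_zero_of_square (f := F) (x := w.re) (δ := -w.im) (by linarith)
      (hFc.mono fun v hv => hsub _ hv.1) (hFd.mono fun v hv => hv.2.2)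
      (fun s hs => Set.indicator_of_notMem (by simp) f)
    have e : (w.re : ℂ) - (-w.im : ℝ) * Complex.I = w := by
      apply Complex.ext <;> simp
    rw [e, hF, Set.indicator_of_mem (show w ∈ {z : ℂ | z.im < 0} from h4)] at this
    exact this
  have hconv : Convex ℝ {z : ℂ | z.im < 0} := convex_halfSpace_im_lt 0
  have han : AnalyticOnNhd ℂ f {z : ℂ | z.im < 0} := hf.analyticOnNhd hopen
  set w₀ : ℂ := x₀ - (η / 2 : ℝ) * Complex.I with hw₀
  have hre : w₀.re = x₀ := by simp [hw₀]
  have him : w₀.im = -(η / 2) := by simp [hw₀]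
  refine han.eqOn_zero_of_preconnected_of_eventuallyEq_zero hconv.isPreconnected (z₀ := w₀)
    (by rw [Set.mem_ofPred_eq, him]; linarith) ?_ hz
  have hO : IsOpen (Set.Ioo (x₀ - η) (x₀ + η) ×ℂ Set.Ioo (-η) 0) := isOpen_Ioo.reProdIm isOpen_Ioo
  filter_upwards [hO.mem_nhds (x := w₀) ⟨by
    rw [Set.mem_preimage, hre]; constructor <;> linarith, by
    rw [Set.mem_preimage, him]; constructor <;> linarith⟩] with w hw
  exact hzero w hw

theorem eq_zero_of_boundary_eq_zero_upper {f : ℂ → ℂ} {a b : ℝ} (hab : a < b)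
    (hf : DifferentiableOn ℂ f {z : ℂ | 0 < z.im})
    (hlim : ∀ x ∈ Set.Ioo a b, Tendsto f (𝓝[{z : ℂ | 0 < z.im}] (x : ℂ)) (𝓝 0))
    {z : ℂ} (hz : 0 < z.im) : f z = 0 := by
  have h := eq_zero_of_boundary_eq_zero (f := fun z => f (-z)) (neg_lt_neg hab)
    (hf.comp (by fun_prop) fun w hw => by simpa using hw) (fun x hx => by
      have hx' : -x ∈ Set.Ioo a b := ⟨by linarith [hx.2], by linarith [hx.1]⟩
      refine (hlim _ hx').comp ?_
      refine tendsto_nhdsWithin_iff.2 ⟨?_, ?_⟩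
      · rw [Complex.ofReal_neg]
        exact (continuous_neg.tendsto _).mono_left nhdsWithin_le_nhds
      · filter_upwards [self_mem_nhdsWithin] with w hw
        simpa using hw) (z := -z) (by simpa using hz)
  simpa using h

/-! ### Positivity of the real part of the jump matrix -/

theorem exp_phaseHat {A y t lam : ℝ} (hA : 0 < A) (h : lam ∈ sigmaDot A) :
    Complex.exp (-phaseHat A y t lam) = (starRingEnd ℂ) (Complex.exp (phaseHat A y t lam)) ∧
      Complex.exp (phaseHat A y t lam) *
        (starRingEnd ℂ) (Complex.exp (phaseHat A y t lam)) = 1 := by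
  obtain ⟨l, hl, -⟩ := exists_rootL_eq_of_mem_sigmaDot hA h
  have hθ : phaseHat A y t lam = ((A * l / 2 * (y - 2 * t / lam ^ 2) : ℝ) : ℂ) * Complex.I := by
    rw [phaseHat, hl]; push_cast; ring
  have h1 : Complex.exp (-phaseHat A y t lam) =
      (starRingEnd ℂ) (Complex.exp (phaseHat A y t lam)) := by
    rw [← Complex.exp_conj, hθ, map_mul, Complex.conj_ofReal, Complex.conj_I, mul_neg]
  exact ⟨h1, by rw [← h1, ← Complex.exp_add, add_neg_cancel, Complex.exp_zero]⟩

/-- The sesquilinear form `v ↦ v G v*` of a `2 × 2` matrix on row vectors `v = (a, b)`. -/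
noncomputable def rowForm (G : Matrix (Fin 2) (Fin 2) ℂ) (a b : ℂ) : ℂ :=
  (a * G 0 0 + b * G 1 0) * (starRingEnd ℂ) a + (a * G 0 1 + b * G 1 1) * (starRingEnd ℂ) b

theorem re_add_sub_conj (x : ℝ) (w : ℂ) : ((x : ℂ) + (w - (starRingEnd ℂ) w)).re = x := by
  simp

/-- The off-diagonal entries are minus conjugates of each other, so the cross terms form w - w̄ and
contribute nothing to the real part. -/
theorem rowForm_jumpMatrix_sigmaDot {A₁ A₂ y t lam : ℝ} {r : ℝ → ℂ} (hA₁ : 0 < A₁) (hA : A₁ < A₂)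
    (h : lam ∈ sigmaDot A₁) (a b : ℂ) :
    (rowForm (jumpMatrix A₁ A₂ r y t lam) a b).re =
      (1 - ‖r lam‖ ^ 2) * ‖a‖ ^ 2 + ‖b‖ ^ 2 := by
  have h' : lam ∈ sigmaDot A₂ := (one_div_lt_one_div_of_lt hA₁ hA).trans h
  have hn : lam ∉ gammaDot A₂ := fun hg => lt_asymm (show 1 / A₂ < |lam| from h') hg
  obtain ⟨h1, h2⟩ := exp_phaseHat (y := y) (t := t) (hA₁.trans hA) h'
  rw [rowForm, jumpMatrix, if_neg hn, jumpCore, if_pos h, h1]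
  set e := Complex.exp (phaseHat A₂ y t lam)
  rw [← re_add_sub_conj ((1 - ‖r lam‖ ^ 2) * ‖a‖ ^ 2 + ‖b‖ ^ 2)
    (b * (starRingEnd ℂ) a * r lam * e ^ 2)]
  congr 1
  simp only [Matrix.mul_apply, Fin.sum_univ_two, Matrix.of_apply, Matrix.cons_val',
    Matrix.cons_val_zero, Matrix.cons_val_one, Matrix.cons_val_fin_one, map_mul, map_pow, Complex.conj_conj]
  push_cast
  rw [← Complex.mul_conj' a, ← Complex.mul_conj' b]
  linear_combination (a * (starRingEnd ℂ) a * (1 - ‖r lam‖ ^ 2) + b * (starRingEnd ℂ) b) * h2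

/-- Unimodularity gives 1/r = r̄, which restores the cancellation of cross terms seen on Σ̇₁. -/
theorem rowForm_jumpMatrix_sigmaZeroDot {A₁ A₂ y t lam : ℝ} {r : ℝ → ℂ} (hA₂ : 0 < A₂)
    (h : lam ∈ sigmaZeroDot A₁ A₂) (hr : ‖r lam‖ = 1) (a b : ℂ) :
    (rowForm (jumpMatrix A₁ A₂ r y t lam) a b).re = ‖b‖ ^ 2 := by
  have hn : lam ∉ gammaDot A₂ := fun hg => lt_asymm h.1 hg
  have hn' : lam ∉ sigmaDot A₁ := fun hg => lt_asymm (show 1 / A₁ < |lam| from hg) h.2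
  obtain ⟨h1, h2⟩ := exp_phaseHat (y := y) (t := t) hA₂ h.1
  have hr' : 1 / r lam = (starRingEnd ℂ) (r lam) := by
    rw [one_div, Complex.inv_def, Complex.normSq_eq_norm_sq, hr]; simp
  rw [rowForm, jumpMatrix, if_neg hn, jumpCore, if_neg hn', h1, hr']
  set e := Complex.exp (phaseHat A₂ y t lam)
  rw [← re_add_sub_conj (‖b‖ ^ 2) (b * (starRingEnd ℂ) a * r lam * e ^ 2)]
  congr 1
  simp only [Matrix.mul_apply, Fin.sum_univ_two, Matrix.of_apply, Matrix.cons_val',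
    Matrix.cons_val_zero, Matrix.cons_val_one, Matrix.cons_val_fin_one, map_mul, map_pow, Complex.conj_conj]
  push_cast
  rw [← Complex.mul_conj' b]
  linear_combination (b * (starRingEnd ℂ) b) * h2

theorem rowForm_jumpMatrix_gammaDot {A₁ A₂ y t lam : ℝ} {r : ℝ → ℂ}
    (h : lam ∈ gammaDot A₂) (a b : ℂ) :
    (rowForm (jumpMatrix A₁ A₂ r y t lam) a b).re = 0 := by
  rw [rowForm, jumpMatrix, if_pos h]
  simp
  ring

theorem rowForm_jumpMatrix_nonneg {A₁ A₂ : ℝ} (hA₁ : 0 < A₁) (hA : A₁ < A₂) {u₀ : ℝ → ℝ}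
    (hu₀ : IsStepLike A₁ A₂ u₀) {r : ℝ → ℂ} (hr : IsReflectionCoefficient A₁ A₂ u₀ r)
    {y t lam : ℝ} (h : lam ∉ branchPoints A₁ A₂) (a b : ℂ) :
    0 ≤ (rowForm (jumpMatrix A₁ A₂ r y t lam) a b).re := by
  simp only [branchPoints, Set.mem_insert_iff, Set.mem_singleton_iff, not_or] at h
  have hA₂ := hA₁.trans hA
  have n1 : |lam| ≠ 1 / A₁ := fun he => by
    rcases (abs_eq (by positivity)).1 he with h' | h' <;> tauto
  have n2 : |lam| ≠ 1 / A₂ := fun he => by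
    rcases (abs_eq (by positivity)).1 he with h' | h' <;> tauto
  rcases n2.lt_or_gt with h2 | h2
  · exact (rowForm_jumpMatrix_gammaDot h2 a b).ge
  · rcases n1.lt_or_gt with h1 | h1
    · rw [rowForm_jumpMatrix_sigmaZeroDot hA₂ ⟨h2, h1⟩ (hr.norm_eq_one hA₁ hA hu₀ ⟨h2, h1⟩)]
      positivity
    · rw [rowForm_jumpMatrix_sigmaDot hA₁ hA h1]
      have := hr.norm_lt_one hA₁ hA h1
      have : 0 ≤ 1 - ‖r lam‖ ^ 2 := by nlinarith [norm_nonneg (r lam)]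
      positivity

/-! ### The product m(z) m(z̄)* and vanishing of the boundary values -/

/-- The `i`-th diagonal entry of `m(z) m(z̄)*`. -/
noncomputable def hermRow (m : ℂ → Matrix (Fin 2) (Fin 2) ℂ) (i : Fin 2) (z : ℂ) : ℂ :=
  m z i 0 * (starRingEnd ℂ) (m ((starRingEnd ℂ) z) i 0) +
    m z i 1 * (starRingEnd ℂ) (m ((starRingEnd ℂ) z) i 1)

theorem isOpen_offReal : IsOpen offReal :=
  isOpen_ne_fun Complex.continuous_im continuous_const

theorem IsHomogeneousSolution.differentiableOn_hermRow {A₁ A₂ y t : ℝ} {r : ℝ → ℂ}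
    {m : ℂ → Matrix (Fin 2) (Fin 2) ℂ} (hm : IsHomogeneousSolution A₁ A₂ r y t m) (i : Fin 2) :
    DifferentiableOn ℂ (hermRow m i) upperSet := by
  have h1 : ∀ j, DifferentiableOn ℂ (fun z => m z i j) upperSet := fun j =>
    (hm.analytic i j).mono fun z hz => ne_of_gt hz
  have h2 : ∀ j, DifferentiableOn ℂ
      (fun z => (starRingEnd ℂ) (m ((starRingEnd ℂ) z) i j)) upperSet := fun j z hz => by
    refine DifferentiableAt.differentiableWithinAt ?_
    have hz' : (starRingEnd ℂ) z ∈ offReal := by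
      have : z.im ≠ 0 := ne_of_gt hz
      simpa [offReal] using this
    have := ((hm.analytic i j).differentiableAt (isOpen_offReal.mem_nhds hz')).conj_conj
    rwa [Complex.conj_conj] at this
  exact ((h1 0).mul (h2 0)).add ((h1 1).mul (h2 1))

theorem IsHomogeneousSolution.exists_decay {A₁ A₂ y t : ℝ} {r : ℝ → ℂ}
    {m : ℂ → Matrix (Fin 2) (Fin 2) ℂ} (hm : IsHomogeneousSolution A₁ A₂ r y t m) :
    ∃ C R : ℝ, 0 ≤ C ∧ 0 < R ∧
      ∀ z : ℂ, z.im ≠ 0 → R ≤ ‖z‖ → ∀ i j, ‖m z i j‖ ≤ C * ‖z‖⁻¹ := by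
  have h : ∀ p : Fin 2 × Fin 2, ∃ C : ℝ, ∀ᶠ z in Bornology.cobounded ℂ ⊓ 𝓟 offReal,
      ‖m z p.1 p.2‖ ≤ C * ‖z⁻¹‖ := fun p => (hm.decay p.1 p.2).bound
  choose C hC using h
  have hall := eventually_inf_principal.1 (eventually_all.2 hC)
  rw [← comap_norm_atTop, eventually_comap] at hall
  obtain ⟨R, hR⟩ := eventually_atTop.1 hall
  refine ⟨∑ p, |C p|, max R 1, Finset.sum_nonneg fun _ _ => abs_nonneg _, by positivity,
    fun z hz hzR i j => ?_⟩
  refine (hR ‖z‖ ((le_max_left _ _).trans hzR) z rfl hz (i, j)).trans ?_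
  rw [norm_inv]
  gcongr
  exact (le_abs_self _).trans
    (Finset.single_le_sum (f := fun p => |C p|) (fun _ _ => abs_nonneg _) (Finset.mem_univ (i, j)))

theorem norm_hermRow_le {m : ℂ → Matrix (Fin 2) (Fin 2) ℂ} {i : Fin 2} {z : ℂ} {B : ℝ}
    (h : ∀ j, ‖m z i j‖ ≤ B) (h' : ∀ j, ‖m ((starRingEnd ℂ) z) i j‖ ≤ B) :
    ‖hermRow m i z‖ ≤ 2 * B ^ 2 := by
  have hB : 0 ≤ B := (norm_nonneg _).trans (h 0)
  have : ∀ j, ‖m z i j * (starRingEnd ℂ) (m ((starRingEnd ℂ) z) i j)‖ ≤ B ^ 2 := fun j => by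
    rw [norm_mul, RCLike.norm_conj, sq]
    exact mul_le_mul (h j) (h' j) (norm_nonneg _) hB
  exact (norm_add_le _ _).trans (by linarith [this 0, this 1])

theorem tendsto_conj_upperSet (x : ℝ) :
    Tendsto (starRingEnd ℂ) (𝓝[upperSet] (x : ℂ)) (𝓝[{z : ℂ | z.im < 0}] (x : ℂ)) := by
  refine tendsto_nhdsWithin_iff.2 ⟨?_, ?_⟩
  · have := Complex.continuous_conj.tendsto (x : ℂ)
    rw [Complex.conj_ofReal] at this
    exact this.mono_left nhdsWithin_le_nhds
  · filter_upwards [self_mem_nhdsWithin] with z hz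
    simpa using hz

/-- Conjugation preserves the distance to a real point, so the two factors of order -1/4 multiply to
order -1/2, which is integrable. -/
theorem IsHomogeneousSolution.hermRow_singularity {A₁ A₂ y t : ℝ} {r : ℝ → ℂ}
    {m : ℂ → Matrix (Fin 2) (Fin 2) ℂ} (hm : IsHomogeneousSolution A₁ A₂ r y t m) (i : Fin 2)
    {s : ℝ} (hs : s ∈ branchPoints A₁ A₂) :
    ∃ C, ∀ᶠ z in 𝓝[upperSet] (s : ℂ), ‖hermRow m i z‖ ≤ C * ‖z - (s : ℂ)‖ ^ (-(1 / 2) : ℝ) := by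
  have h : ∀ j : Fin 2, ∃ C : ℝ, ∀ᶠ z in 𝓝[offReal] (s : ℂ),
      ‖m z i j‖ ≤ C * ‖‖z - (s : ℂ)‖ ^ (-(1 / 4) : ℝ)‖ := fun j => (hm.singularity s hs i j).bound
  choose C hC using h
  have hC' : ∀ᶠ z in 𝓝[offReal] (s : ℂ), ∀ j,
      ‖m z i j‖ ≤ (∑ j, |C j|) * ‖z - (s : ℂ)‖ ^ (-(1 / 4) : ℝ) := by
    filter_upwards [eventually_all.2 hC] with z hz j
    have h0 := Real.rpow_nonneg (norm_nonneg (z - (s : ℂ))) (-(1 / 4) : ℝ)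
    refine (hz j).trans ?_
    rw [Real.norm_of_nonneg h0]
    gcongr
    exact (le_abs_self _).trans
      (Finset.single_le_sum (f := fun p => |C p|) (fun _ _ => abs_nonneg _) (Finset.mem_univ j))
  have hup : 𝓝[upperSet] (s : ℂ) ≤ 𝓝[offReal] (s : ℂ) :=
    nhdsWithin_mono _ fun z hz => ne_of_gt hz
  have hlow : Tendsto (starRingEnd ℂ) (𝓝[upperSet] (s : ℂ)) (𝓝[offReal] (s : ℂ)) :=
    (tendsto_conj_upperSet s).mono_right (nhdsWithin_mono _ fun z hz => ne_of_lt hz)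
  refine ⟨2 * (∑ j, |C j|) ^ 2, ?_⟩
  filter_upwards [hup hC', hlow.eventually hC'] with z h1 h2
  have e : ‖(starRingEnd ℂ) z - (s : ℂ)‖ = ‖z - (s : ℂ)‖ := by
    rw [← RCLike.norm_conj (z - (s : ℂ)), map_sub, Complex.conj_ofReal]
  rw [e] at h2
  refine (norm_hermRow_le h1 h2).trans (le_of_eq ?_)
  have hp : (‖z - (s : ℂ)‖ ^ (-(1 / 4) : ℝ)) ^ 2 = ‖z - (s : ℂ)‖ ^ (-(1 / 2) : ℝ) := by
    rw [← Real.rpow_natCast, ← Real.rpow_mul (norm_nonneg _)]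
    norm_num
  rw [mul_pow, hp, mul_assoc]

/-- The boundary values of a homogeneous solution vanish on the unbounded part of the contour. -/
theorem IsHomogeneousSolution.boundary_eq_zero {A₁ A₂ : ℝ} (hA₁ : 0 < A₁) (hA : A₁ < A₂)
    {u₀ : ℝ → ℝ} (hu₀ : IsStepLike A₁ A₂ u₀) {r : ℝ → ℂ}
    (hr : IsReflectionCoefficient A₁ A₂ u₀ r) {y t : ℝ}
    {m : ℂ → Matrix (Fin 2) (Fin 2) ℂ} (hm : IsHomogeneousSolution A₁ A₂ r y t m)
    {lam : ℝ} (hlam : lam ∈ sigmaDot A₁) :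
    Tendsto m (𝓝[{z : ℂ | 0 < z.im}] (lam : ℂ)) (𝓝 0) ∧
      Tendsto m (𝓝[{z : ℂ | z.im < 0}] (lam : ℂ)) (𝓝 0) := by
  have hA₂ := hA₁.trans hA
  have hbr : lam ∉ branchPoints A₁ A₂ := by
    have h1 : 1 / A₁ < |lam| := hlam
    have h2 := one_div_lt_one_div_of_lt hA₁ hA
    have p1 : 0 < 1 / A₁ := by positivity
    have p2 : 0 < 1 / A₂ := by positivity
    simp only [branchPoints, Set.mem_insert_iff, Set.mem_singleton_iff]
    rintro (rfl | rfl | rfl | rfl)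
    · rw [abs_of_pos p1] at h1; linarith
    · rw [abs_neg, abs_of_pos p1] at h1; linarith
    · rw [abs_of_pos p2] at h1; linarith
    · rw [abs_neg, abs_of_pos p2] at h1; linarith
  have hex := hm.jump
  choose! P M hP hM hJ using hex
  set S : Finset ℝ := {1 / A₁, -(1 / A₁), 1 / A₂, -(1 / A₂)} with hS
  have hmemS : ∀ x, x ∈ S ↔ x ∈ branchPoints A₁ A₂ := fun x => by simp [hS, branchPoints]
  have hM0 : M lam = 0 := by
    have hrow : ∀ i, M lam i 0 = 0 ∧ M lam i 1 = 0 := by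
      intro i
      obtain ⟨C, R, hC, hR, hdec⟩ := hm.exists_decay
      -- As z tends to the axis from above, z̄ does so from below, so the boundary value is the row
      -- of `P` paired with that of `M`; substituting the jump relation for `P` leaves a form in `M`
      -- alone.
      have key := boundary_re_eq_zero (F := hermRow m i) (S := S) (C := 2 * C ^ 2) (R₀ := R)
        (G := fun x => rowForm (jumpMatrix A₁ A₂ r y t x) (M x i 0) (M x i 1))
        (hm.differentiableOn_hermRow i)
        (fun z hz hzR => by
          refine (norm_hermRow_le (hdec z hz.ne' hzR i)
            (B := C * ‖z‖⁻¹) (fun j => ?_)).trans (le_of_eq ?_)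
          · have := hdec ((starRingEnd ℂ) z) (by simpa using hz.ne')
              (by rwa [RCLike.norm_conj]) i j
            rwa [RCLike.norm_conj z] at this
          · rw [mul_pow, inv_pow, ← mul_assoc, div_eq_mul_inv])
        (by positivity)
        (fun x hx => by
          rw [hmemS] at hx
          have e : ∀ j, P x i j = M x i 0 * jumpMatrix A₁ A₂ r y t x 0 j +
              M x i 1 * jumpMatrix A₁ A₂ r y t x 1 j := fun j => by
            rw [hJ x hx, Matrix.mul_apply, Fin.sum_univ_two]
          have hp := fun j => tendsto_pi_nhds.1 (tendsto_pi_nhds.1 (hP x hx) i) j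
          have hq := fun j => (Complex.continuous_conj.tendsto _).comp
            ((tendsto_pi_nhds.1 (tendsto_pi_nhds.1 (hM x hx) i) j).comp (tendsto_conj_upperSet x))
          have := ((hp 0).mul (hq 0)).add ((hp 1).mul (hq 1))
          rw [e 0, e 1] at this
          exact this)
        (fun s hs => hm.hermRow_singularity i ((hmemS s).1 hs))
        (fun x hx => rowForm_jumpMatrix_nonneg hA₁ hA hu₀ hr (by rwa [← hmemS]) _ _)
        (x := lam) (by rwa [hmemS])
      simp only [rowForm_jumpMatrix_sigmaDot hA₁ hA hlam] at key
      have hlt := hr.norm_lt_one hA₁ hA hlam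
      have hpos : 0 < 1 - ‖r lam‖ ^ 2 := by nlinarith [norm_nonneg (r lam)]
      have h1 := mul_nonneg hpos.le (sq_nonneg ‖M lam i 0‖)
      have h2 := sq_nonneg ‖M lam i 1‖
      refine ⟨?_, ?_⟩
      · have : (1 - ‖r lam‖ ^ 2) * ‖M lam i 0‖ ^ 2 = 0 := by linarith
        simpa [hpos.ne'] using this
      · have : ‖M lam i 1‖ ^ 2 = 0 := by linarith
        simpa using this
    ext i j
    fin_cases j
    · exact (hrow i).1
    · exact (hrow i).2
  have hP0 : P lam = 0 := by rw [hJ lam hbr, hM0, zero_mul]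
  exact ⟨hP0 ▸ hP lam hbr, hM0 ▸ hM lam hbr⟩

end StepMCH

theorem mainTheorem4 (A₁ A₂ : ℝ) (hA₁ : 0 < A₁) (hA₁₂ : A₁ < A₂)
    (u₀ : ℝ → ℝ) (hu₀ : StepMCH.IsStepLike A₁ A₂ u₀)
    (r : ℝ → ℂ) (hr : StepMCH.IsReflectionCoefficient A₁ A₂ u₀ r)
    (y t : ℝ) (ht : 0 < t)
    (m : ℂ → Matrix (Fin 2) (Fin 2) ℂ)
    (hm : StepMCH.IsHomogeneousSolution A₁ A₂ r y t m) :
    ∀ z : ℂ, z.im ≠ 0 → m z = 0 := by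
  intro z hz
  have hmem : ∀ x ∈ Set.Ioo (1 / A₁) (1 / A₁ + 1), x ∈ StepMCH.sigmaDot A₁ := fun x hx =>
    hx.1.trans_le (le_abs_self x)
  have hb := fun x hx => hm.boundary_eq_zero hA₁ hA₁₂ hu₀ hr (hmem x hx)
  ext i j
  rcases hz.lt_or_gt with h | h
  · exact StepMCH.eq_zero_of_boundary_eq_zero (f := fun z => m z i j) (lt_add_one (1 / A₁))
      ((hm.analytic i j).mono fun w hw => ne_of_lt hw)
      (fun x hx => tendsto_pi_nhds.1 (tendsto_pi_nhds.1 (hb x hx).2 i) j) h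
  · exact StepMCH.eq_zero_of_boundary_eq_zero_upper (f := fun z => m z i j) (lt_add_one (1 / A₁))
      ((hm.analytic i j).mono fun w hw => ne_of_gt hw)
      (fun x hx => tendsto_pi_nhds.1 (tendsto_pi_nhds.1 (hb x hx).1 i) j) h
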